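/- Let $d\ge 2$, $I=[0,1]$, and let $\mathcal D\subset\mathbb R^d$ be a smoothly embedded closed $d$-dimensional ball. Let $C\subset\mathcal D\times I$ be a covered region: writing $C_t=C\cap(\mathbb R^d\times\{t\})$, the set $C\subset\mathbb R^d\times I$ is a smoothly embedded compact $(d+1)$-dimensional manifold with corners which is a cobordism between the manifolds with boundary $C_0$ and $C_1$, that is, $\partial C=C_0\cup N\cup C_1$ where $N$ is an embedded $d$-dimensional manifold with boundary $\partial N=\partial C_0\sqcup\partial C_1$ and $N\cap C_i=\partial C_i$ for $i=0,1$; the set $\partial\mathcal D\times I$ is a connected component of $N$; and the critical points of the projection $N\to I$ are isolated and have distinct critical values, all lying in $(0,1)$. Let $B=N\setminus(\partial\mathcal D\times I)$ be the essential boundary, $X=((\mathcal D\times I)\setminus C)\cup B$ the uncovered region, and let $\mathcal E$ be the space of evasion paths, i.e. of continuous sections $I\to X$ of the projection $X\to I$, with the compact-open topology. Choose regular values $0=s_0<s_1<\dots<s_n=1$ of the projection $B\to I$ such that each $[s_i,s_{i+1}]$ contains at most one critical value of it (for example, values interleaving the critical values). Put $B_i=B\cap(\mathbb R^d\times\{s_i\})$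 and $B_i^{i+1}=B\cap(\mathbb R^d\times[s_i,s_{i+1}])$, and let $\widetilde{ZB}$ be the zigzag of inclusions $$B_0\hookrightarrow B_0^1\hookleftarrow B_1\hookrightarrow\cdots\hookrightarrow B_{n-1}^n\hookleftarrow B_n .$$ Let $k$ be a field, let $H^0(-;k)$ be degree-zero singular cohomology regarded as a $k$-algebra under the cup product, and let $\varprojlim \mathrm{Hom}_{k\text{-alg}}(H^0(\widetilde{ZB};k),k)$ be the inverse limit of the zigzag diagram of sets obtained by applying $\mathrm{Hom}_{k\text{-alg}}(H^0(-;k),k)$ to $\widetilde{ZB}$. Assume that $C_t$ is connected for every $t\in I$. Then there is a surjection $$\pi_0(\mathcal E)\longrightarrow\varprojlim \mathrm{Hom}_{k\text{-alg}}(H^0(\widetilde{ZB};k),k).$$ In particular, an evasion path exists (i.e. $\mathcal E\neq\emptyset$) if and only if this inverse limit is nonempty, and the cardinality of $\pi_0(\mathcal E)$ is at least the cardinality of the inverse limit. -/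

import Mathlib

open Set Topology
open scoped ContDiff

universe u

noncomputable section

namespace Evasion

/-! ### Singular cohomology in degree zero, with its cup product -/

/-- Singular `n`-simplices of a topological space. -/
abbrev SingularSimplex (n : ℕ) (A : Type*) [TopologicalSpace A] : Type _ :=
  C(stdSimplex ℝ (Fin (n + 1)), A)

/-- The `i`-th face of a singular simplex. -/
def SingularSimplex.face {n : ℕ} {A : Type*} [TopologicalSpace A]
    (σ : SingularSimplex (n + 1) A) (i : Fin (n + 2)) : SingularSimplex n A :=
  σ.comp ⟨stdSimplex.map i.succAbove, stdSimplex.continuous_map _⟩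

/-- Singular `n`-cochains with coefficients in `k`. -/
abbrev SingularCochain (n : ℕ) (k A : Type*) [TopologicalSpace A] : Type _ :=
  SingularSimplex n A → k

/-- The singular coboundary. -/
def coboundary {n : ℕ} {k A : Type*} [Ring k] [TopologicalSpace A]
    (φ : SingularCochain n k A) : SingularCochain (n + 1) k A :=
  fun σ => ∑ i : Fin (n + 2), (-1) ^ (i : ℕ) * φ (σ.face i)

theorem coboundary_zero_apply {k A : Type*} [Ring k] [TopologicalSpace A]
    (φ : SingularCochain 0 k A) (σ : SingularSimplex 1 A) :
    coboundary φ σ = φ (σ.face 0) - φ (σ.face 1) := by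
  simp [coboundary, Fin.sum_univ_two, sub_eq_add_neg]

/-- The `k`-algebra `H⁰(A; k)`: the `0`-cocycles of the singular cochain complex (there are no
nonzero `0`-coboundaries). The cup product of `0`-cochains is the pointwise product. -/
def H0 (k A : Type*) [Field k] [TopologicalSpace A] : Subalgebra k (SingularCochain 0 k A) where
  carrier := {φ | coboundary φ = 0}
  mul_mem' := by
    intro φ ψ hφ hψ
    funext σ
    have h1 := congrFun hφ σ
    have h2 := congrFun hψ σ
    rw [coboundary_zero_apply, Pi.zero_apply, sub_eq_zero] at h1 h2 ⊢
    simp [h1, h2]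
  add_mem' := by
    intro φ ψ hφ hψ
    funext σ
    have h1 := congrFun hφ σ
    have h2 := congrFun hψ σ
    rw [coboundary_zero_apply, Pi.zero_apply, sub_eq_zero] at h1 h2 ⊢
    simp [h1, h2]
  algebraMap_mem' := by
    intro c
    funext σ
    rw [coboundary_zero_apply]
    simp [Pi.algebraMap_apply]

/-- The algebra map `H⁰(A'; k) → H⁰(A; k)` induced by a continuous map `A → A'`. -/
def H0.map (k : Type*) [Field k] {A A' : Type*} [TopologicalSpace A] [TopologicalSpace A']
    (f : C(A, A')) : H0 k A' →ₐ[k] H0 k A where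
  toFun φ := ⟨fun σ => φ.1 (f.comp σ), by
    funext σ
    have h := congrFun φ.2 (f.comp σ)
    rw [coboundary_zero_apply] at h ⊢
    exact h⟩
  map_one' := rfl
  map_mul' _ _ := rfl
  map_zero' := rfl
  map_add' _ _ := rfl
  commutes' _ := rfl

/-- The set `Hom_{k-alg}(H⁰(A; k), k)`. -/
abbrev H0Dual (k A : Type*) [Field k] [TopologicalSpace A] : Type _ := H0 k A →ₐ[k] k

/-- The map `Hom_{k-alg}(H⁰(A; k), k) → Hom_{k-alg}(H⁰(A'; k), k)` induced by a continuous map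
`A → A'`. -/
def H0Dual.map {k : Type*} [Field k] {A A' : Type*} [TopologicalSpace A] [TopologicalSpace A']
    (f : C(A, A')) (χ : H0Dual k A) : H0Dual k A' :=
  χ.comp (H0.map k f)

/-! ### Embedded cobordisms of manifolds with boundary -/

/-- `ℝᵈ`. -/
abbrev Space (d : ℕ) : Type := EuclideanSpace ℝ (Fin d)

/-- `ℝᵈ × ℝ`, with time as second coordinate. -/
abbrev SpaceTime (d : ℕ) : Type := Space d × ℝ

/-- Smooth charts of `ℝᵈ × ℝ`: diffeomorphisms between open subsets of `ℝᵈ × ℝ` and `ℝᵈ⁺¹`. -/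
def IsSmoothChart {d : ℕ} (e : OpenPartialHomeomorph (SpaceTime d) (Space (d + 1))) : Prop :=
  ContDiffOn ℝ ∞ e e.source ∧ ContDiffOn ℝ ∞ e.symm e.target

/-- At `p`, the set `M` is a codimension-`0` submanifold with boundary, `p` lies on the boundary,
and `F` is the boundary of `M` near `p`. -/
def IsFacePoint {d : ℕ} (M F : Set (SpaceTime d)) (p : SpaceTime d) : Prop :=
  ∃ e : OpenPartialHomeomorph (SpaceTime d) (Space (d + 1)), IsSmoothChart e ∧
    p ∈ e.source ∧ e p 0 = 0 ∧
    e.source ∩ M = {q ∈ e.source | 0 ≤ e q 0} ∧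
    e.source ∩ F = {q ∈ e.source | e q 0 = 0}

/-- At `p`, the set `M` is a codimension-`0` submanifold with corners modelled on
`[0, ∞)² × ℝᵈ⁻¹`, `p` lies on the corner, and `F`, `G` are the two faces of `M` near `p`. -/
def IsCornerPoint {d : ℕ} (M F G : Set (SpaceTime d)) (p : SpaceTime d) : Prop :=
  ∃ e : OpenPartialHomeomorph (SpaceTime d) (Space (d + 1)), IsSmoothChart e ∧
    p ∈ e.source ∧ e p 0 = 0 ∧ e p 1 = 0 ∧
    e.source ∩ M = {q ∈ e.source | 0 ≤ e q 0 ∧ 0 ≤ e q 1} ∧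
    e.source ∩ F = {q ∈ e.source | e q 0 = 0 ∧ 0 ≤ e q 1} ∧
    e.source ∩ G = {q ∈ e.source | 0 ≤ e q 0 ∧ e q 1 = 0}

/-- `M ⊆ ℝᵈ × ℝ` is a smoothly embedded compact `(d+1)`-dimensional cobordism of manifolds with
boundary between `M₀` and `M₁`, with boundary `∂M = M₀ ∪ N ∪ M₁`. The pieces `M₀`, `N`, `M₁` are
embedded `d`-dimensional manifolds with boundary, `M₀ ∩ M₁ = ∅`, `∂M₀ = M₀ ∩ N`, `∂M₁ = M₁ ∩ N` and
`∂N = ∂M₀ ⊔ ∂M₁`; the corners of `M` are the points of `∂N`. All of this is expressed by charts of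
`M` adapted to the decomposition of its boundary. -/
structure IsCobordism {d : ℕ} (M M₀ N M₁ : Set (SpaceTime d)) : Prop where
  isCompact : IsCompact M
  boundary_eq : frontier M = M₀ ∪ N ∪ M₁
  disjoint : Disjoint M₀ M₁
  isClosed_left : IsClosed M₀
  isClosed_side : IsClosed N
  isClosed_right : IsClosed M₁
  face_left : ∀ p ∈ M₀ \ N, IsFacePoint M M₀ p
  face_side : ∀ p ∈ N \ (M₀ ∪ M₁), IsFacePoint M N p
  face_right : ∀ p ∈ M₁ \ N, IsFacePoint M M₁ p
  corner_left : ∀ p ∈ M₀ ∩ N, IsCornerPoint M M₀ N p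
  corner_right : ∀ p ∈ M₁ ∩ N, IsCornerPoint M M₁ N p

/-- Critical points of the projection `N → ℝ`, `(x, t) ↦ t`, of an embedded submanifold `N` of
`ℝᵈ × ℝ` (possibly with boundary): the projection vanishes on the tangent space of `N` at `p`. -/
def IsCriticalPoint {d : ℕ} (N : Set (SpaceTime d)) (p : SpaceTime d) : Prop :=
  p ∈ N ∧ ∀ v ∈ tangentConeAt ℝ N p, v.2 = 0

/-- Critical values of the projection `N → ℝ`. -/
def criticalValues {d : ℕ} (N : Set (SpaceTime d)) : Set ℝ :=
  Prod.snd '' {p | IsCriticalPoint N p}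

/-! ### The smoothed evasion path problem -/

/-- `D ⊆ ℝᵈ` is a smoothly embedded closed `d`-dimensional ball. -/
def IsSmoothBall {d : ℕ} (D : Set (Space d)) : Prop :=
  ∃ φ : Space d → Space d, ContDiff ℝ ∞ φ ∧ InjOn φ (Metric.closedBall 0 1) ∧
    (∀ x ∈ Metric.closedBall (0 : Space d) 1, Function.Injective (fderiv ℝ φ x)) ∧
    φ '' Metric.closedBall 0 1 = D

/-- The part of `M` at time `t`, as a subspace of `ℝᵈ × ℝ`. -/
def levelSet {d : ℕ} (M : Set (SpaceTime d)) (t : ℝ) : Set (SpaceTime d) :=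
  {p ∈ M | p.2 = t}

/-- The part of `M` over the time interval `[a, b]`. -/
def slab {d : ℕ} (M : Set (SpaceTime d)) (a b : ℝ) : Set (SpaceTime d) :=
  {p ∈ M | p.2 ∈ Icc a b}

theorem levelSet_subset_slab {d : ℕ} (M : Set (SpaceTime d)) {a b t : ℝ} (h : t ∈ Icc a b) :
    levelSet M t ⊆ slab M a b := by
  rintro p ⟨hp, rfl⟩
  exact ⟨hp, h⟩

/-- `C` is a covered region in `D × [0, 1]`, and `N` is the part of the boundary of `C` joining
`∂C₀` to `∂C₁`. -/
structure IsCoveredRegion {d : ℕ} (D : Set (Space d)) (C N : Set (SpaceTime d)) : Prop where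
  subset : C ⊆ D ×ˢ Icc 0 1
  isCobordism : IsCobordism C (levelSet C 0) N (levelSet C 1)
  wall_isComponent : ∃ p ∈ N, connectedComponentIn N p = frontier D ×ˢ Icc 0 1
  critical_isolated : ∀ p, IsCriticalPoint N p → ∀ᶠ q in 𝓝 p, IsCriticalPoint N q → q = p
  critical_injOn : InjOn Prod.snd {p | IsCriticalPoint N p}
  critical_mem : ∀ p, IsCriticalPoint N p → p.2 ∈ Ioo 0 1

/-- The essential boundary `B`. -/
def essentialBoundary {d : ℕ} (D : Set (Space d)) (N : Set (SpaceTime d)) : Set (SpaceTime d) :=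
  N \ (frontier D ×ˢ Icc 0 1)

/-- The uncovered region `X = ((D × [0, 1]) \ C) ∪ B`. -/
def uncoveredRegion {d : ℕ} (D : Set (Space d)) (C N : Set (SpaceTime d)) : Set (SpaceTime d) :=
  ((D ×ˢ Icc 0 1) \ C) ∪ essentialBoundary D N

/-- The space of evasion paths: continuous sections `[0, 1] → X` of the projection `X → [0, 1]`,
with the compact-open topology. -/
abbrev EvasionPath {d : ℕ} (D : Set (Space d)) (C N : Set (SpaceTime d)) : Type :=
  {δ : C(unitInterval, uncoveredRegion D C N) // ∀ t, (δ t : SpaceTime d).2 = t}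

/-- Regular values `0 = s₀ < s₁ < ⋯ < sₙ = 1` of the projection `B → [0, 1]` with at most one
critical value between consecutive ones. -/
structure Interleaving {d : ℕ} (B : Set (SpaceTime d)) (n : ℕ) where
  s : Fin (n + 1) → ℝ
  strictMono : StrictMono s
  zero : s 0 = 0
  last : s (Fin.last n) = 1
  regular : ∀ i, s i ∉ criticalValues B
  subsingleton : ∀ i : Fin n, (criticalValues B ∩ Icc (s i.castSucc) (s i.succ)).Subsingleton

/-- The inclusion of the level set at `sᵢ` into the slab over `[sᵢ, sᵢ₊₁]`. -/
def Interleaving.inclLeft {d n : ℕ} {B : Set (SpaceTime d)} (S : Interleaving B n)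
    (M : Set (SpaceTime d)) (i : Fin n) :
    C(levelSet M (S.s i.castSucc), slab M (S.s i.castSucc) (S.s i.succ)) :=
  ContinuousMap.inclusion
    (levelSet_subset_slab M (left_mem_Icc.2 (S.strictMono i.castSucc_lt_succ).le))

/-- The inclusion of the level set at `sᵢ₊₁` into the slab over `[sᵢ, sᵢ₊₁]`. -/
def Interleaving.inclRight {d n : ℕ} {B : Set (SpaceTime d)} (S : Interleaving B n)
    (M : Set (SpaceTime d)) (i : Fin n) :
    C(levelSet M (S.s i.succ), slab M (S.s i.castSucc) (S.s i.succ)) :=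
  ContinuousMap.inclusion
    (levelSet_subset_slab M (right_mem_Icc.2 (S.strictMono i.castSucc_lt_succ).le))

/-- The inverse limit of the zigzag of sets
`Hom(H⁰(M₀), k) → Hom(H⁰(M₀¹), k) ← Hom(H⁰(M₁), k) → ⋯ ← Hom(H⁰(Mₙ), k)`: compatible families. -/
def ZigzagLimit (k : Type*) [Field k] {d n : ℕ} {B : Set (SpaceTime d)} (S : Interleaving B n)
    (M : Set (SpaceTime d)) : Type _ :=
  {χ : (∀ i : Fin (n + 1), H0Dual k (levelSet M (S.s i))) ×
      (∀ i : Fin n, H0Dual k (slab M (S.s i.castSucc) (S.s i.succ))) //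
    ∀ i : Fin n, H0Dual.map (S.inclLeft M i) (χ.1 i.castSucc) = χ.2 i ∧
      H0Dual.map (S.inclRight M i) (χ.1 i.succ) = χ.2 i}

end Evasion

end

/-!
Evasion paths are sections of `X → I`, and the characters of `H⁰` of a compact locally path
connected space are the evaluations at its path components, so the inverse limit consists of chains
of components of the spaces `Bᵢ` in which consecutive ones lie in a common component of `Bᵢ^{i+1}`.

An evasion path determines such a chain because two points of `B` over `[a, b]` that lie in one
component of `X` over `[a, b]` lie in one component of `B` over `[a, b]`. Indeed `ℝᵈ × [a, b]` is
contractible and is covered by `X` and by the outer region `C ∪ (Dᶜ × I)`, which meet in `B`; the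
outer region is connected since each `C_t` is, and in a contractible space the intersection of a
connected closed set with a component of a closed set covering the rest is connected.

Conversely, over a slab with at most one critical point, any two points in the same component of `X`
on the two end levels are joined by a section. Away from the critical point `X` is locally a product
with the time axis, so reachability is an open and closed condition there. At the critical point the
normal of `B` points along the time axis, hence `X` lies on one side of the graph of a function of
position, and a section that comes close to the critical point can be continued past it.
-/

namespace Evasion

/-! ### Unicoherence of contractible sets -/

section Unicoherence

theorem exists_real_lift_of_contractible {A : Type*} [TopologicalSpace A] [ContractibleSpace A]
    (θ : C(A, AddCircle (1 : ℝ))) : ∃ g : C(A, ℝ), ∀ a, (g a : AddCircle (1 : ℝ)) = θ a := by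
  obtain ⟨a₀, ⟨H⟩⟩ := (contractible_iff_id_nullhomotopic A).1 ‹_›
  obtain ⟨r, hr⟩ := QuotientAddGroup.mk_surjective (θ a₀)
  have hcov := AddCircle.isCoveringMap_coe (1 : ℝ)
  let contraction : C(unitInterval × A, AddCircle (1 : ℝ)) := θ.comp H.symm.toContinuousMap
  have contraction_zero : ∀ a, contraction (0, a) = (ContinuousMap.const A r a : ℝ) := fun a =>
    (congrArg θ (H.symm.apply_zero a)).trans hr.symm
  have contraction_one : ∀ a, contraction (1, a) = θ a := fun a =>
    congrArg θ (H.symm.apply_one a)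
  refine ⟨(hcov.liftHomotopy contraction _ contraction_zero).comp
    ((ContinuousMap.const A 1).prodMk (ContinuousMap.id A)), fun a => ?_⟩
  rw [← contraction_one]
  exact congrFun (hcov.liftHomotopy_lifts contraction _ contraction_zero) (1, a)

variable {T : Type*} [TopologicalSpace T]

theorem exists_real_lift_of_contractible_subset {A : Set T} [ContractibleSpace A]
    {θ : T → AddCircle (1 : ℝ)} (hθ : ContinuousOn θ A) :
    ∃ g : T → ℝ, ContinuousOn g A ∧ ∀ a ∈ A, (g a : AddCircle (1 : ℝ)) = θ a := by
  classical
  obtain ⟨g, hg⟩ := exists_real_lift_of_contractible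
    (⟨A.domRestrict θ, continuousOn_iff_continuous_domRestrict.1 hθ⟩ : C(A, AddCircle (1 : ℝ)))
  refine ⟨fun x => if h : x ∈ A then g ⟨x, h⟩ else 0, ?_, fun a ha => ?_⟩
  · rw [continuousOn_iff_continuous_domRestrict]
    convert g.continuous with x
    simp
  · simp only [ha, dite_true]
    exact hg ⟨a, ha⟩

theorem sub_eq_sub_of_coe_eq {K : Set T} (hK : IsPreconnected K) {f g : T → ℝ}
    (hf : ContinuousOn f K) (hg : ContinuousOn g K)
    (h : ∀ x ∈ K, (f x : AddCircle (1 : ℝ)) = g x) {x y : T} (hx : x ∈ K) (hy : y ∈ K) :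
    f x - g x = f y - g y := by
  have hdiscrete : DiscreteTopology ((AddSubgroup.zmultiples (1 : ℝ) : AddSubgroup ℝ) : Set ℝ) :=
    inferInstanceAs (DiscreteTopology (AddSubgroup.zmultiples (1 : ℝ)))
  refine hK.constant_of_mapsTo (T := (AddSubgroup.zmultiples (1 : ℝ) : Set ℝ))
    ⟨hdiscrete⟩ (hf.sub hg) (fun z hz => ?_) hx hy
  simpa [sub_eq_neg_add] using QuotientAddGroup.eq.1 (h z hz).symm

theorem exists_isClosed_partition_of_notMem_connectedComponentIn [T2Space T] {B : Set T}
    (hB : IsCompact B) {b b' : T} (hb : b ∈ B) (hb' : b' ∈ B)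
    (h : b' ∉ connectedComponentIn B b) :
    ∃ P Q : Set T, IsClosed P ∧ IsClosed Q ∧ Disjoint P Q ∧ P ∪ Q = B ∧ b ∈ P ∧ b' ∈ Q := by
  have := isCompact_iff_compactSpace.1 hB
  have hcomponent : (⟨b', hb'⟩ : B) ∉ connectedComponent (⟨b, hb⟩ : B) := fun hmem => by
    rw [connectedComponentIn_eq_image hb] at h
    exact h ⟨_, hmem, rfl⟩
  rw [connectedComponent_eq_iInter_isClopen] at hcomponent
  simp only [mem_iInter, not_forall] at hcomponent
  obtain ⟨⟨Z, hZ, hbZ⟩, hb'Z⟩ := hcomponent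
  refine ⟨Subtype.val '' Z, Subtype.val '' Zᶜ, ?_, ?_, ?_, ?_, ⟨_, hbZ, rfl⟩, ⟨_, hb'Z, rfl⟩⟩
  · exact (hZ.1.isCompact.image continuous_subtype_val).isClosed
  · exact (hZ.compl.1.isCompact.image continuous_subtype_val).isClosed
  · exact (disjoint_image_iff Subtype.val_injective).2 disjoint_compl_right
  · rw [← image_union, union_compl_self, image_univ, Subtype.range_coe]

/- Otherwise `X ∩ Y` splits into closed sets `P ∋ b` and `Q ∋ b'`, and a function that is `0` on `P`
and `1` on `Q` descends to a circle-valued map on `X ∪ Y` once `Y` is sent to the base point. A real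
lift of this map is constant on `Y`, but increases by `1` along `K`. -/
theorem mem_connectedComponentIn_inter_of_contractible [T4Space T] {X Y K : Set T}
    (hX : IsClosed X) (hY : IsClosed Y) [ContractibleSpace (X ∪ Y : Set T)]
    (hYc : IsPreconnected Y) (hXY : IsCompact (X ∩ Y)) (hK : IsPreconnected K) (hKX : K ⊆ X)
    {b b' : T} (hb : b ∈ K) (hbY : b ∈ Y) (hb' : b' ∈ K) (hb'Y : b' ∈ Y) :
    b' ∈ connectedComponentIn (X ∩ Y) b := by
  classical
  by_contra h
  obtain ⟨P, Q, hP, hQ, hPQ, hunion, hbP, hb'Q⟩ :=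
    exists_isClosed_partition_of_notMem_connectedComponentIn hXY ⟨hKX hb, hbY⟩ ⟨hKX hb', hb'Y⟩ h
  obtain ⟨u, hu_zero, hu_one, -⟩ := exists_continuous_zero_one_of_isClosed hP hQ hPQ
  let θ : T → AddCircle (1 : ℝ) := fun x => if x ∈ Y then ((0 : ℝ) : AddCircle (1 : ℝ)) else u x
  have hθY : ∀ x ∈ Y, θ x = ((0 : ℝ) : AddCircle (1 : ℝ)) := fun x hx => if_pos hx
  have hθX : ∀ x ∈ X, θ x = u x := fun x hx => by
    by_cases hxY : x ∈ Y
    · rw [hθY x hxY]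
      rcases hunion.ge ⟨hx, hxY⟩ with hxP | hxQ
      · rw [hu_zero hxP, Pi.zero_apply]
      · rw [hu_one hxQ, Pi.one_apply, AddCircle.coe_period, AddCircle.coe_zero]
    · exact if_neg hxY
  have hθ : ContinuousOn θ (X ∪ Y) :=
    (((AddCircle.continuous_mk' 1).comp u.continuous).continuousOn.congr hθX).union_of_isClosed
      (continuousOn_const.congr hθY) hX hY
  obtain ⟨g, hg, hgθ⟩ := exists_real_lift_of_contractible_subset hθ
  have increment_K : g b - u b = g b' - u b' :=
    sub_eq_sub_of_coe_eq hK (hg.mono (hKX.trans subset_union_left)) u.continuous.continuousOn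
      (fun x hx => by rw [hgθ x (.inl (hKX hx)), hθX x (hKX hx)]) hb hb'
  have increment_Y : g b - 0 = g b' - 0 :=
    sub_eq_sub_of_coe_eq hYc (hg.mono subset_union_right) continuousOn_const
      (fun x hx => by rw [hgθ x (.inr hx), hθY x hx]) hbY hb'Y
  have hub : u b = 0 := hu_zero hbP
  have hub' : u b' = 1 := hu_one hb'Q
  linarith

end Unicoherence

/-! ### Reachability along sections -/

section Reach

variable {E : Type*} [TopologicalSpace E] {Z Z' : Set (E × ℝ)} {q r m x : E × ℝ}

/-- `r` can be reached from `q` along a continuous section of the projection `Z → ℝ` defined over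
the time interval between them. Sections are encoded by their space component `σ`. -/
def Reach (Z : Set (E × ℝ)) (q r : E × ℝ) : Prop :=
  q.2 ≤ r.2 ∧ ∃ σ : ℝ → E, ContinuousOn σ (Icc q.2 r.2) ∧ (∀ t ∈ Icc q.2 r.2, (σ t, t) ∈ Z) ∧
    σ q.2 = q.1 ∧ σ r.2 = r.1

theorem Reach.refl (h : q ∈ Z) : Reach Z q q :=
  ⟨le_rfl, fun _ => q.1, continuousOn_const, fun t ht => by
    rw [Icc_self, mem_singleton_iff] at ht
    subst ht
    exact h, rfl, rfl⟩

theorem Reach.left_mem (h : Reach Z q r) : q ∈ Z := by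
  obtain ⟨hle, σ, -, hσ, hq, -⟩ := h
  simpa only [hq] using hσ q.2 (left_mem_Icc.2 hle)

theorem Reach.right_mem (h : Reach Z q r) : r ∈ Z := by
  obtain ⟨hle, σ, -, hσ, -, hr⟩ := h
  simpa only [hr] using hσ r.2 (right_mem_Icc.2 hle)

theorem Reach.eq_of_snd_eq (h : Reach Z q r) (hqr : q.2 = r.2) : q = r := by
  obtain ⟨-, σ, -, -, hq, hr⟩ := h
  exact Prod.ext (by rw [← hq, ← hr, hqr]) hqr

theorem Reach.mono (h : Reach Z q r) (hZ : ∀ z ∈ Z, z.2 ∈ Icc q.2 r.2 → z ∈ Z') :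
    Reach Z' q r := by
  obtain ⟨hle, σ, hc, hσ, hq, hr⟩ := h
  exact ⟨hle, σ, hc, fun t ht => hZ _ (hσ t ht) ht, hq, hr⟩

theorem Reach.trans (h : Reach Z q r) (h' : Reach Z r m) : Reach Z q m := by
  obtain ⟨hle, σ, hc, hσ, hq, hr⟩ := h
  obtain ⟨hle', σ', hc', hσ', hr', hm⟩ := h'
  let τ : ℝ → E := fun t => if t ≤ r.2 then σ t else σ' t
  have hτ : ∀ t ∈ Icc q.2 r.2, τ t = σ t := fun t ht => if_pos ht.2
  have hτ' : ∀ t ∈ Icc r.2 m.2, τ t = σ' t := fun t ht => by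
    rcases ht.1.eq_or_lt with rfl | hlt
    · rw [hτ _ (right_mem_Icc.2 hle), hr, hr']
    · exact if_neg hlt.not_ge
  refine ⟨hle.trans hle', τ, ?_, ?_, ?_, ?_⟩
  · rw [← Icc_union_Icc_eq_Icc hle hle']
    exact (hc.congr hτ).union_of_isClosed (hc'.congr hτ') isClosed_Icc isClosed_Icc
  · intro t ht
    rw [← Icc_union_Icc_eq_Icc hle hle'] at ht
    rcases ht with ht | ht
    · rw [hτ t ht]; exact hσ t ht
    · rw [hτ' t ht]; exact hσ' t ht
  · rw [hτ _ (left_mem_Icc.2 hle), hq]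
  · rw [hτ' _ (right_mem_Icc.2 hle'), hm]

theorem Reach.exists_section (h : Reach Z q r) :
    ∃ σ : ℝ → E, ContinuousOn σ (Icc q.2 r.2) ∧
      (∀ t ∈ Icc q.2 r.2, Reach Z q (σ t, t) ∧ Reach Z (σ t, t) r) ∧ σ q.2 = q.1 ∧ σ r.2 = r.1 := by
  obtain ⟨-, σ, hc, hσ, hq, hr⟩ := h
  refine ⟨σ, hc, fun t ht => ⟨?_, ?_⟩, hq, hr⟩
  · have hsub : Icc q.2 t ⊆ Icc q.2 r.2 := Icc_subset_Icc_right ht.2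
    exact ⟨ht.1, σ, hc.mono hsub, fun s hs => hσ s (hsub hs), hq, rfl⟩
  · have hsub : Icc t r.2 ⊆ Icc q.2 r.2 := Icc_subset_Icc_left ht.1
    exact ⟨ht.2, σ, hc.mono hsub, fun s hs => hσ s (hsub hs), rfl, hr⟩

theorem Reach.exists_reach_at_time (h : Reach Z q r) {t : ℝ} (ht : t ∈ Icc q.2 r.2) :
    ∃ m, m.2 = t ∧ Reach Z q m ∧ Reach Z m r := by
  obtain ⟨σ, -, hσ, -⟩ := h.exists_section
  exact ⟨(σ t, t), rfl, hσ t ht⟩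

theorem Reach.exists_isPreconnected (h : Reach Z q r) :
    ∃ K ⊆ Z, IsPreconnected K ∧ q ∈ K ∧ r ∈ K ∧ ∀ k ∈ K, k.2 ∈ Icc q.2 r.2 := by
  obtain ⟨hle, σ, hc, hσ, hq, hr⟩ := h
  refine ⟨(fun t => (σ t, t)) '' Icc q.2 r.2, image_subset_iff.2 hσ,
    isPreconnected_Icc.image _ (hc.prodMk continuousOn_id),
    ⟨q.2, left_mem_Icc.2 hle, Prod.ext hq rfl⟩, ⟨r.2, right_mem_Icc.2 hle, Prod.ext hr rfl⟩, ?_⟩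
  rintro _ ⟨t, ht, rfl⟩
  exact ht

theorem Reach.exists_lt_mem (h : Reach Z q r) (hlt : q.2 < r.2) {U : Set (E × ℝ)} (hU : IsOpen U)
    (hr : r ∈ U) : ∃ m ∈ U ∩ Z, m.2 ∈ Ioo q.2 r.2 ∧ Reach Z q m ∧ Reach Z m r := by
  obtain ⟨σ, hc, hσ, -, hσr⟩ := h.exists_section
  have hgraph : ContinuousWithinAt (fun t => (σ t, t)) (Ioo q.2 r.2) r.2 :=
    ((hc.prodMk continuousOn_id) _ (right_mem_Icc.2 h.1)).mono Ioo_subset_Icc_self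
  have hnear : ∀ᶠ t in 𝓝[Ioo q.2 r.2] r.2, (σ t, t) ∈ U :=
    hgraph.eventually (hU.mem_nhds (by simpa only [hσr] using hr))
  have : (𝓝[Ioo q.2 r.2] r.2).NeBot := right_nhdsWithin_Ioo_neBot hlt
  obtain ⟨t, htU, ht⟩ := (hnear.and self_mem_nhdsWithin).exists
  have hreach := hσ t (Ioo_subset_Icc_self ht)
  exact ⟨(σ t, t), ⟨htU, hreach.1.right_mem⟩, ht, hreach⟩

/-- The reflection of time, used to deduce statements about the past from statements about the
future. -/
def flipTime : E × ℝ ≃ₜ E × ℝ := (Homeomorph.refl E).prodCongr (Homeomorph.neg ℝ)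

@[simp] theorem flipTime_fst (q : E × ℝ) : (flipTime q).1 = q.1 := rfl

@[simp] theorem flipTime_snd (q : E × ℝ) : (flipTime q).2 = -q.2 := rfl

@[simp] theorem flipTime_flipTime (q : E × ℝ) : flipTime (flipTime q) = q :=
  Prod.ext rfl (neg_neg q.2)

@[simp] theorem preimage_flipTime_preimage_flipTime (Z : Set (E × ℝ)) :
    flipTime ⁻¹' (flipTime ⁻¹' Z) = Z := by
  ext q
  simp only [mem_preimage, flipTime_flipTime]

theorem Reach.flip (h : Reach Z q r) : Reach (flipTime ⁻¹' Z) (flipTime r) (flipTime q) := by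
  obtain ⟨hle, σ, hc, hσ, hq, hr⟩ := h
  have hneg : MapsTo (fun t => -t) (Icc (-r.2) (-q.2)) (Icc q.2 r.2) := fun t ht =>
    ⟨le_neg.1 ht.2, neg_le.1 ht.1⟩
  exact ⟨neg_le_neg hle, fun t => σ (-t), hc.comp continuous_neg.continuousOn hneg,
    fun t ht => hσ (-t) (hneg ht), by simpa using hr, by simpa using hq⟩

theorem reach_flipTime_iff :
    Reach (flipTime ⁻¹' Z) (flipTime r) (flipTime q) ↔ Reach Z q r :=
  ⟨fun h => by simpa using h.flip, Reach.flip⟩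

theorem Reach.exists_gt_mem (h : Reach Z q r) (hlt : q.2 < r.2) {U : Set (E × ℝ)} (hU : IsOpen U)
    (hq : q ∈ U) : ∃ m ∈ U ∩ Z, m.2 ∈ Ioo q.2 r.2 ∧ Reach Z q m ∧ Reach Z m r := by
  obtain ⟨m, hmUZ, hm, hrm, hmq⟩ := h.flip.exists_lt_mem (by simpa using hlt)
    (hU.preimage flipTime.continuous) (by simpa using hq)
  refine ⟨flipTime m, hmUZ, ⟨lt_neg.1 hm.2, neg_lt.1 hm.1⟩, ?_, ?_⟩
  · rw [← reach_flipTime_iff]; simpa using hmq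
  · rw [← reach_flipTime_iff]; simpa using hrm

/-- Near `q`, any two points of `Z` at distinct times are joined by a section. -/
def RegularAt (Z : Set (E × ℝ)) (q : E × ℝ) : Prop :=
  ∃ U, IsOpen U ∧ q ∈ U ∧ ∀ r ∈ U ∩ Z, ∀ r' ∈ U ∩ Z, r.2 < r'.2 → Reach Z r r'

theorem RegularAt.inter_of_ordConnected (h : RegularAt Z q) {J : Set ℝ} (hJ : J.OrdConnected) :
    RegularAt (Z ∩ Prod.snd ⁻¹' J) q := by
  obtain ⟨U, hU, hq, h⟩ := h
  refine ⟨U, hU, hq, fun r hr r' hr' hlt => ?_⟩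
  exact (h r ⟨hr.1, hr.2.1⟩ r' ⟨hr'.1, hr'.2.1⟩ hlt).mono
    fun z hz hzt => ⟨hz, hJ.out hr.2.2 hr'.2.2 hzt⟩

theorem RegularAt.flip (h : RegularAt Z q) : RegularAt (flipTime ⁻¹' Z) (flipTime q) := by
  obtain ⟨U, hU, hq, h⟩ := h
  refine ⟨flipTime ⁻¹' U, hU.preimage flipTime.continuous, by simpa using hq, ?_⟩
  intro r hr r' hr' hlt
  rw [← flipTime_flipTime r, ← flipTime_flipTime r', reach_flipTime_iff]
  exact h _ hr' _ hr (by simpa using hlt)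

theorem regularAt_flipTime_iff : RegularAt (flipTime ⁻¹' Z) (flipTime q) ↔ RegularAt Z q :=
  ⟨fun h => by simpa using h.flip, RegularAt.flip⟩

theorem RegularAt.reach_congr (hZ : RegularAt Z q) :
    ∃ U, IsOpen U ∧ q ∈ U ∧ ∀ r ∈ U ∩ Z, ∀ r' ∈ U ∩ Z, r.2 = r'.2 → ∀ y, r.2 < y.2 →
      (Reach Z r y ↔ Reach Z r' y) := by
  obtain ⟨U, hU, hq, h⟩ := hZ
  have reach_of_reach : ∀ r ∈ U ∩ Z, ∀ r' ∈ U ∩ Z, r.2 = r'.2 → ∀ y, r.2 < y.2 →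
      Reach Z r y → Reach Z r' y := by
    intro r hr r' hr' hrr' y hy hry
    obtain ⟨m, hm, hmt, -, hmy⟩ := hry.exists_gt_mem hy hU hr.1
    exact (h r' hr' m hm (hrr' ▸ hmt.1)).trans hmy
  exact ⟨U, hU, hq, fun r hr r' hr' hrr' y hy =>
    ⟨reach_of_reach r hr r' hr' hrr' y hy, reach_of_reach r' hr' r hr hrr'.symm y (hrr' ▸ hy)⟩⟩

theorem eventually_not_reach_of_slice_partition [T2Space E] (hZ : IsCompact Z) {t : ℝ}
    {P Q : Set (E × ℝ)} (hP : IsCompact P) (hQ : IsCompact Q) (hPQ : Disjoint P Q)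
    (hcover : Z ∩ Prod.snd ⁻¹' {t} ⊆ P ∪ Q) (hPt : P ⊆ Prod.snd ⁻¹' {t}) (hr : r ∈ Q)
    (hrt : r.2 = t) : ∀ᶠ q in 𝓝 r, ∀ m ∈ P, ¬ Reach Z m q := by
  obtain ⟨U, V, hU, hV, hPU, hQV, hUV⟩ := SeparatedNhds.of_isCompact_isCompact hP hQ hPQ
  have hcompl : (Prod.snd '' (Z \ (U ∪ V)))ᶜ ∈ 𝓝 t := by
    refine ((hZ.diff (hU.union hV)).image continuous_snd).isClosed.isOpen_compl.mem_nhds ?_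
    rintro ⟨z, ⟨hz, hzUV⟩, hzt⟩
    exact hzUV ((hcover ⟨hz, hzt⟩).imp (@hPU z) (@hQV z))
  have hbetween : ∀ᶠ q : E × ℝ in 𝓝 r, uIcc t q.2 ⊆ (Prod.snd '' (Z \ (U ∪ V)))ᶜ :=
    Filter.tendsto_smallSets_iff.1 (Filter.Tendsto.uIcc (tendsto_const_nhds (x := t))
      (continuous_snd.tendsto' r t hrt)) _ hcompl
  filter_upwards [hV.mem_nhds (hQV hr), hbetween] with q hqV hq m hm hmq
  have hmt : m.2 = t := hPt hm
  obtain ⟨K, hKZ, hK, hmK, hqK, hKt⟩ := hmq.exists_isPreconnected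
  have hKUV : K ⊆ U ∪ V := fun k hk => by
    by_contra hkUV
    refine hq ?_ ⟨k, ⟨hKZ hk, hkUV⟩, rfl⟩
    rw [← hmt, uIcc_of_le hmq.1]
    exact hKt k hk
  rcases hK.subset_or_subset hU hV hUV hKUV with hKU | hKV
  · exact hUV.le_bot ⟨hKU hqK, hqV⟩
  · exact hUV.le_bot ⟨hPU hm, hKV hmK⟩

end Reach

/-! ### The set of reachable points -/

section ReachSet

variable {E : Type*} [TopologicalSpace E] {Z : Set (E × ℝ)} {p q r x z w : E × ℝ}

/-- The points strictly later than `x` that can be reached from `x`. -/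
def laterReach (Z : Set (E × ℝ)) (x : E × ℝ) : Set (E × ℝ) := {r | x.2 < r.2 ∧ Reach Z x r}

/-- The points simultaneous with `x` from which the same later points can be reached. -/
def coinitial (Z : Set (E × ℝ)) (x : E × ℝ) : Set (E × ℝ) :=
  {z ∈ Z | z.2 = x.2 ∧ ∀ y, x.2 < y.2 → (Reach Z x y ↔ Reach Z z y)}

/-- The points reachable from `x`. The initial slice contributes all of `coinitial Z x` rather than
`x` alone, since only then can the set be clopen in `Z`. -/
def reachSet (Z : Set (E × ℝ)) (x : E × ℝ) : Set (E × ℝ) := coinitial Z x ∪ laterReach Z x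

theorem mem_reachSet_iff_of_lt (h : x.2 < r.2) : r ∈ reachSet Z x ↔ Reach Z x r :=
  ⟨fun hr => hr.elim (fun hr => absurd hr.2.1 h.ne') (fun hr => hr.2), fun hr => .inr ⟨h, hr⟩⟩

theorem Reach.mem_reachSet (h : Reach Z x r) : r ∈ reachSet Z x := by
  rcases h.1.eq_or_lt with heq | hlt
  · obtain rfl := h.eq_of_snd_eq heq
    exact .inl ⟨h.left_mem, rfl, fun _ _ => Iff.rfl⟩
  · exact .inr ⟨hlt, h⟩

theorem laterReach_subset : laterReach Z x ⊆ Z := fun _ hr => hr.2.right_mem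

theorem reachSet_subset : reachSet Z x ⊆ Z :=
  union_subset (fun _ hr => hr.1) laterReach_subset

theorem Reach.trans_mem_reachSet (hq : q ∈ reachSet Z x) (h : Reach Z q r) :
    r ∈ reachSet Z x := by
  rcases hq with hq | hq
  · rcases h.1.eq_or_lt with heq | hlt
    · exact h.eq_of_snd_eq heq ▸ .inl hq
    · have hxr : x.2 < r.2 := hq.2.1 ▸ hlt
      exact .inr ⟨hxr, (hq.2.2 r hxr).2 h⟩
  · exact .inr ⟨hq.1.trans_le h.1, hq.2.trans h⟩

/-- The point `x` lies in the initial time slice of `Z`, and `Z` is regular along that slice and at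
every limit of points reachable from `x`: the conditions under which `reachSet Z x` is clopen. -/
structure RegularFrom (Z : Set (E × ℝ)) (x : E × ℝ) : Prop where
  le_snd : ∀ z ∈ Z, x.2 ≤ z.2
  regularAt_initial : ∀ z ∈ Z, z.2 = x.2 → RegularAt Z z
  regularAt_limit : ∀ r ∈ closure (laterReach Z x), RegularAt Z r

theorem RegularAt.eventually_mem_coinitial_iff (hz : RegularAt Z z) (hzZ : z ∈ Z)
    (hzx : z.2 = x.2) :
    ∀ᶠ w in 𝓝 z, w ∈ Z ∩ Prod.snd ⁻¹' {x.2} → (w ∈ coinitial Z x ↔ z ∈ coinitial Z x) := by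
  obtain ⟨U, hU, hzU, h⟩ := hz.reach_congr
  filter_upwards [hU.mem_nhds hzU] with w hwU ⟨hwZ, hwx⟩
  have hwx : w.2 = x.2 := hwx
  have hwz : ∀ y, x.2 < y.2 → (Reach Z w y ↔ Reach Z z y) := fun y hy =>
    h w ⟨hwU, hwZ⟩ z ⟨hzU, hzZ⟩ (hwx.trans hzx.symm) y (hwx ▸ hy)
  exact ⟨fun hw => ⟨hzZ, hzx, fun y hy => (hw.2.2 y hy).trans (hwz y hy)⟩,
    fun hz => ⟨hwZ, hwx, fun y hy => (hz.2.2 y hy).trans (hwz y hy).symm⟩⟩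

theorem isClosed_inter_time (hZ : IsClosed Z) (t : ℝ) : IsClosed (Z ∩ Prod.snd ⁻¹' {t}) :=
  hZ.inter (isClosed_singleton.preimage continuous_snd)

namespace RegularFrom

theorem isClosed_coinitial (h : RegularFrom Z x) (hZ : IsClosed Z) :
    IsClosed (coinitial Z x) := by
  have hsub : coinitial Z x ⊆ Z ∩ Prod.snd ⁻¹' {x.2} := fun w hw => ⟨hw.1, hw.2.1⟩
  refine isClosed_of_closure_subset fun z hz => ?_
  obtain ⟨hzZ, hzx⟩ := closure_minimal hsub (isClosed_inter_time hZ x.2) hz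
  obtain ⟨w, hw, hwz⟩ := ((mem_closure_iff_frequently.1 hz).and_eventually
    ((h.regularAt_initial z hzZ hzx).eventually_mem_coinitial_iff hzZ hzx)).exists
  exact (hwz (hsub hw)).1 hw

theorem isClosed_diff_coinitial (h : RegularFrom Z x) (hZ : IsClosed Z) :
    IsClosed ((Z ∩ Prod.snd ⁻¹' {x.2}) \ coinitial Z x) := by
  refine isClosed_of_closure_subset fun z hz => ?_
  obtain ⟨hzZ, hzx⟩ := closure_minimal sdiff_subset (isClosed_inter_time hZ x.2) hz
  obtain ⟨w, hw, hwz⟩ := ((mem_closure_iff_frequently.1 hz).and_eventually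
    ((h.regularAt_initial z hzZ hzx).eventually_mem_coinitial_iff hzZ hzx)).exists
  exact ⟨⟨hzZ, hzx⟩, fun hmem => hw.2 ((hwz hw.1).2 hmem)⟩

theorem regularAt_of_mem_closure_reachSet (h : RegularFrom Z x) (hZ : IsClosed Z)
    (hr : r ∈ closure (reachSet Z x)) : RegularAt Z r := by
  rw [reachSet, closure_union, (h.isClosed_coinitial hZ).closure_eq] at hr
  exact hr.elim (fun hr => h.regularAt_initial r hr.1 hr.2.1) (h.regularAt_limit r)

theorem isClosed_diff_reachSet (h : RegularFrom Z x) (hZ : IsClosed Z) :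
    IsClosed (Z \ reachSet Z x) := by
  refine isClosed_of_closure_subset fun r hr => ?_
  have hrZ : r ∈ Z := closure_minimal sdiff_subset hZ hr
  refine ⟨hrZ, fun hrR => ?_⟩
  obtain ⟨U, hU, hrU, hjoin⟩ := h.regularAt_of_mem_closure_reachSet hZ (subset_closure hrR)
  rcases hrR with hrS | ⟨hlt, hxr⟩
  · obtain ⟨w, ⟨hwU, hw⟩, hwR⟩ := mem_closure_iff.1 hr _
      (hU.inter (h.isClosed_diff_coinitial hZ).isOpen_compl) ⟨hrU, fun hmem => hmem.2 hrS⟩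
    rcases (h.le_snd w hwR.1).eq_or_lt with heq | hlt
    · exact hw ⟨⟨hwR.1, heq.symm⟩, fun hmem => hwR.2 (.inl hmem)⟩
    · exact hwR.2 (Reach.trans_mem_reachSet (.inl hrS)
        (hjoin r ⟨hrU, hrZ⟩ w ⟨hwU, hwR.1⟩ (hrS.2.1 ▸ hlt)))
  · obtain ⟨m, hm, hmt, hxm, -⟩ := hxr.exists_lt_mem hlt hU hrU
    obtain ⟨w, ⟨hwU, hw⟩, hwR⟩ := mem_closure_iff.1 hr (U ∩ Prod.snd ⁻¹' Ioi m.2)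
      (hU.inter (isOpen_Ioi.preimage continuous_snd)) ⟨hrU, hmt.2⟩
    exact hwR.2 (hxm.trans (hjoin m hm w ⟨hwU, hwR.1⟩ hw)).mem_reachSet

theorem isClosed_reachSet_inter_time (h : RegularFrom Z x) (hZ : IsClosed Z) (t : ℝ) :
    IsClosed (reachSet Z x ∩ Prod.snd ⁻¹' {t}) := by
  obtain rfl | ht := eq_or_ne x.2 t
  · convert h.isClosed_coinitial hZ using 1
    ext r
    exact ⟨fun hr => hr.1.resolve_right fun hlater => hlater.1.ne' hr.2,
      fun hr => ⟨.inl hr, hr.2.1⟩⟩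
  refine isClosed_of_closure_subset fun r hr => ?_
  obtain ⟨hrZ, hrt⟩ :=
    closure_minimal (inter_subset_inter_left _ reachSet_subset) (isClosed_inter_time hZ t) hr
  obtain ⟨U, hU, hrU, hjoin⟩ :=
    h.regularAt_of_mem_closure_reachSet hZ (closure_mono inter_subset_left hr)
  obtain ⟨w, hwU, hwR, hwt⟩ := mem_closure_iff.1 hr U hU hrU
  have hwt : w.2 = t := hwt
  have hlt : x.2 < w.2 := (h.le_snd w (reachSet_subset hwR)).lt_of_ne (hwt ▸ ht)
  obtain ⟨m, hm, hmt, hxm, -⟩ := ((mem_reachSet_iff_of_lt hlt).1 hwR).exists_lt_mem hlt hU hwU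
  have hmr : m.2 < r.2 := (hmt.2.trans_eq hwt).trans_eq hrt.symm
  exact ⟨(hxm.trans (hjoin m hm r ⟨hrU, hrZ⟩ hmr)).mem_reachSet, hrt⟩

theorem eventually_not_reach [T2Space E] {Z' : Set (E × ℝ)} (h : RegularFrom Z x)
    (hZ : IsCompact Z) (hZ' : IsCompact Z') (hslice : Z' ∩ Prod.snd ⁻¹' {r.2} ⊆ Z) (hrZ : r ∈ Z)
    (hr : r ∉ reachSet Z x) :
    ∀ᶠ w in 𝓝 r, ∀ m ∈ reachSet Z x, m.2 = r.2 → ¬ Reach Z' m w := by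
  have hP : IsCompact (reachSet Z x ∩ Prod.snd ⁻¹' {r.2}) :=
    hZ.of_isClosed_subset (h.isClosed_reachSet_inter_time hZ.isClosed r.2)
      (inter_subset_left.trans reachSet_subset)
  have hQ : IsCompact ((Z \ reachSet Z x) ∩ Prod.snd ⁻¹' {r.2}) :=
    hZ.of_isClosed_subset (isClosed_inter_time (h.isClosed_diff_reachSet hZ.isClosed) r.2)
      (inter_subset_left.trans sdiff_subset)
  have hcover : Z' ∩ Prod.snd ⁻¹' {r.2} ⊆ reachSet Z x ∩ Prod.snd ⁻¹' {r.2} ∪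
      (Z \ reachSet Z x) ∩ Prod.snd ⁻¹' {r.2} := fun z hz => by
    by_cases hzR : z ∈ reachSet Z x
    · exact .inl ⟨hzR, hz.2⟩
    · exact .inr ⟨⟨hslice hz, hzR⟩, hz.2⟩
  filter_upwards [eventually_not_reach_of_slice_partition hZ' hP hQ
    (disjoint_sdiff_right.mono inter_subset_left inter_subset_left) hcover inter_subset_right
    ⟨⟨hrZ, hr⟩, rfl⟩ rfl] with w hw m hm hmt
  exact hw m ⟨hm, hmt⟩

theorem isClosed_reachSet [T2Space E] (h : RegularFrom Z x) (hZ : IsCompact Z) :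
    IsClosed (reachSet Z x) := by
  refine isClosed_of_closure_subset fun r hr => ?_
  by_contra hrR
  have hrZ : r ∈ Z := closure_minimal reachSet_subset hZ.isClosed hr
  obtain ⟨U, hU, hrU, hjoin⟩ := h.regularAt_of_mem_closure_reachSet hZ.isClosed hr
  obtain ⟨w, ⟨hwU, hwsep⟩, hwR⟩ := mem_closure_iff_nhds.1 hr _ (Filter.inter_mem
    (hU.mem_nhds hrU) (h.eventually_not_reach hZ hZ inter_subset_left hrZ hrR))
  have hwZ := reachSet_subset hwR
  rcases lt_or_ge w.2 r.2 with hlt | hge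
  · exact hrR (Reach.trans_mem_reachSet hwR (hjoin w ⟨hwU, hwZ⟩ r ⟨hrU, hrZ⟩ hlt))
  · rcases hwR with hwS | ⟨-, hxw⟩
    · have hwr : w.2 = r.2 := le_antisymm (hwS.2.1 ▸ h.le_snd r hrZ) hge
      exact hwsep w (.inl hwS) hwr (Reach.refl hwZ)
    · obtain ⟨m, hmt, hxm, hmw⟩ := hxw.exists_reach_at_time ⟨h.le_snd r hrZ, hge⟩
      exact hwsep m hxm.mem_reachSet hmt hmw

theorem reach_of_isPreconnected [T2Space E] (h : RegularFrom Z x) (hZ : IsCompact Z)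
    {K : Set (E × ℝ)} (hK : IsPreconnected K) (hKZ : K ⊆ Z) (hq : q ∈ K) (hxq : Reach Z x q)
    (hr : r ∈ K) (hlt : x.2 < r.2) : Reach Z x r := by
  rw [← mem_reachSet_iff_of_lt hlt]
  by_contra hrR
  obtain ⟨z, -, hzR, hz⟩ := isPreconnected_closed_iff.1 hK _ _ (h.isClosed_reachSet hZ)
    (h.isClosed_diff_reachSet hZ.isClosed)
    (fun z hz => (em (z ∈ reachSet Z x)).imp_right fun hzR => ⟨hKZ hz, hzR⟩)
    ⟨q, hq, hxq.mem_reachSet⟩ ⟨r, hr, hKZ hr, hrR⟩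
  exact hz.2 hzR

end RegularFrom

theorem mem_closure_laterReach_before [T2Space E] (hZ : IsCompact Z) (hZx : ∀ z ∈ Z, x.2 ≤ z.2)
    (hxp : x.2 < p.2) (hreg : ∀ z ∈ Z, z ≠ p → RegularAt Z z) (hp : p ∈ closure (laterReach Z x)) :
    p ∈ closure {r ∈ laterReach Z x | r.2 < p.2} := by
  by_contra hnot
  have hpZ : p ∈ Z := closure_minimal laterReach_subset hZ.isClosed hp
  let past : Set (E × ℝ) := Z ∩ Prod.snd ⁻¹' Iic p.2
  have hpast : IsCompact past := hZ.inter_right (isClosed_Iic.preimage continuous_snd)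
  have reach_past {r : E × ℝ} (hr : Reach Z x r) (hrp : r.2 ≤ p.2) : Reach past x r :=
    hr.mono fun z hz hzt => ⟨hz, hzt.2.trans hrp⟩
  have reach_of_past {r : E × ℝ} (hr : Reach past x r) : Reach Z x r :=
    hr.mono fun z hz _ => hz.1
  have hnot_past : p ∉ closure (laterReach past x) := fun hp' => by
    refine hnot (mem_closure_iff.2 fun U hU hpU => ?_)
    obtain ⟨r, hrU, hxr, hr⟩ := mem_closure_iff.1 hp' U hU hpU
    rcases (show r.2 ≤ p.2 from hr.right_mem.2).eq_or_lt with heq | hlt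
    · obtain ⟨m, hm, hmt, hxm, -⟩ := (reach_of_past hr).exists_lt_mem hxr hU hrU
      exact ⟨m, hm.1, ⟨hmt.1, hxm⟩, hmt.2.trans_eq heq⟩
    · exact ⟨r, hrU, ⟨hxr, reach_of_past hr⟩, hlt⟩
  have hreg_past {z : E × ℝ} (hz : z ∈ past) (hzp : z ≠ p) : RegularAt past z :=
    (hreg z hz.1 hzp).inter_of_ordConnected ordConnected_Iic
  have hfrom : RegularFrom past x :=
    { le_snd := fun z hz => hZx z hz.1
      regularAt_initial := fun z hz hzx => hreg_past hz (by rintro rfl; exact hxp.ne' hzx)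
      regularAt_limit := fun z hz => hreg_past
        (closure_minimal laterReach_subset hpast.isClosed hz) (by rintro rfl; exact hnot_past hz) }
  have hpR : p ∉ reachSet past x := fun hpR =>
    hnot_past (subset_closure ⟨hxp, (mem_reachSet_iff_of_lt hxp).1 hpR⟩)
  obtain ⟨w, ⟨hwsep, hwnot⟩, hxw, hw⟩ := mem_closure_iff_nhds.1 hp _ (Filter.inter_mem
    (hfrom.eventually_not_reach hpast hZ (fun z hz => ⟨hz.1, hz.2.le⟩) ⟨hpZ, le_refl p.2⟩ hpR)
    (isClosed_closure.isOpen_compl.mem_nhds hnot))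
  have hpw : p.2 ≤ w.2 := not_lt.1 fun hlt => hwnot (subset_closure ⟨⟨hxw, hw⟩, hlt⟩)
  obtain ⟨m, hmt, hxm, hmw⟩ := hw.exists_reach_at_time ⟨hxp.le, hpw⟩
  exact hwsep m (reach_past hxm hmt.le).mem_reachSet hmt hmw

end ReachSet

/-! ### Passing a single singular point -/

section Parametrization

variable {E : Type*} [TopologicalSpace E] {Z : Set (E × ℝ)}

theorem reach_of_forall_mem {v : E} {t t' : ℝ} (htt' : t ≤ t') (hZ : ∀ s ∈ Icc t t', (v, s) ∈ Z) :
    Reach Z (v, t) (v, t') :=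
  ⟨htt', fun _ => v, continuousOn_const, hZ, rfl, rfl⟩

theorem reach_of_parametrization {F : Type*} [AddCommGroup F] [Module ℝ F] [TopologicalSpace F]
    [IsTopologicalAddGroup F] [ContinuousSMul ℝ F] {V : Set (F × ℝ)} (hV : Convex ℝ V)
    {Ψ : F × ℝ → E × ℝ} (hΨ : ContinuousOn Ψ V) (hΨZ : MapsTo Ψ V Z)
    (hΨt : ∀ w ∈ V, (Ψ w).2 = w.2) {v v' : F × ℝ} (hv : v ∈ V) (hv' : v' ∈ V) (hlt : v.2 < v'.2) :
    Reach Z (Ψ v) (Ψ v') := by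
  have hpos : 0 < v'.2 - v.2 := sub_pos.2 hlt
  let ℓ : ℝ → F × ℝ := fun s => AffineMap.lineMap v v' ((s - v.2) / (v'.2 - v.2))
  have hℓV : MapsTo ℓ (Icc v.2 v'.2) V := fun s hs =>
    hV.lineMap_mem hv hv' ⟨div_nonneg (sub_nonneg.2 hs.1) hpos.le,
      (div_le_one hpos).2 (sub_le_sub_right hs.2 _)⟩
  have hℓ : Continuous ℓ := AffineMap.lineMap_continuous.comp (by fun_prop)
  have hℓt : ∀ s, (ℓ s).2 = s := fun s => by
    simp only [ℓ, AffineMap.lineMap_apply, vsub_eq_sub, vadd_eq_add, Prod.snd_add, Prod.smul_snd,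
      Prod.snd_sub, smul_eq_mul, div_mul_cancel₀ _ hpos.ne', sub_add_cancel]
  have hstart : ℓ v.2 = v := by simp [ℓ]
  have hend : ℓ v'.2 = v' := by simp [ℓ, div_self hpos.ne']
  have hreach : Reach Z ((Ψ (ℓ v.2)).1, v.2) ((Ψ (ℓ v'.2)).1, v'.2) := by
    refine ⟨hlt.le, fun s => (Ψ (ℓ s)).1,
      continuous_fst.comp_continuousOn (hΨ.comp hℓ.continuousOn hℓV), fun s hs => ?_, rfl, rfl⟩
    have hs' : (Ψ (ℓ s)).2 = s := (hΨt _ (hℓV hs)).trans (hℓt s)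
    have hmem : ((Ψ (ℓ s)).1, (Ψ (ℓ s)).2) ∈ Z := hΨZ (hℓV hs)
    rwa [hs'] at hmem
  rw [hstart, hend] at hreach
  convert hreach using 1
  exacts [Prod.ext rfl (hΨt _ hv), Prod.ext rfl (hΨt _ hv')]

theorem reach_of_convex_prod [AddCommGroup E] [Module ℝ E] [IsTopologicalAddGroup E]
    [ContinuousSMul ℝ E] {V : Set E} (hV : Convex ℝ V) {v v' : E} {t t' : ℝ} (hv : v ∈ V)
    (hv' : v' ∈ V) (htt' : t < t') (hZ : V ×ˢ Icc t t' ⊆ Z) : Reach Z (v, t) (v', t') :=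
  reach_of_parametrization (Ψ := id) (hV.prod (convex_Icc t t')) continuousOn_id hZ (fun _ _ => rfl)
    ⟨hv, left_mem_Icc.2 htt'.le⟩ ⟨hv', right_mem_Icc.2 htt'.le⟩ htt'

/-- Near `p`, the time slices of `Z` increase with time, and just after `p` the place of `p` lies in
the interior of `Z`. -/
def OpensAt (Z : Set (E × ℝ)) (p : E × ℝ) : Prop :=
  (∃ J ∈ 𝓝 p.2, ∀ᶠ v in 𝓝 p.1, MonotoneOn (fun t => (v, t) ∈ Z) J) ∧
    ∀ᶠ s in 𝓝[>] p.2, Z ∈ 𝓝 (p.1, s)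

/-- Near `p`, the time slices of `Z` decrease with time, and just before `p` the place of `p` lies
in the interior of `Z`. -/
def ClosesAt (Z : Set (E × ℝ)) (p : E × ℝ) : Prop :=
  (∃ J ∈ 𝓝 p.2, ∀ᶠ v in 𝓝 p.1, AntitoneOn (fun t => (v, t) ∈ Z) J) ∧
    ∀ᶠ s in 𝓝[<] p.2, Z ∈ 𝓝 (p.1, s)

variable {p : E × ℝ}

theorem OpensAt.flip (h : OpensAt Z p) : ClosesAt (flipTime ⁻¹' Z) (flipTime p) := by
  obtain ⟨⟨J, hJ, hmono⟩, hint⟩ := h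
  refine ⟨⟨Neg.neg ⁻¹' J,
    continuous_neg.continuousAt.preimage_mem_nhds (by simpa using hJ), ?_⟩, ?_⟩
  · filter_upwards [hmono] with v hv t ht t' ht' hle
    exact hv ht' ht (neg_le_neg hle)
  · have htend : Filter.Tendsto (fun s : ℝ => -s) (𝓝[<] (-p.2)) (𝓝[>] p.2) := by
      simpa using tendsto_neg_nhdsLT (a := -p.2)
    filter_upwards [htend.eventually hint] with s hs
    exact flipTime.continuous.continuousAt.preimage_mem_nhds hs

theorem ClosesAt.flip (h : ClosesAt Z p) : OpensAt (flipTime ⁻¹' Z) (flipTime p) := by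
  obtain ⟨⟨J, hJ, hmono⟩, hint⟩ := h
  refine ⟨⟨Neg.neg ⁻¹' J,
    continuous_neg.continuousAt.preimage_mem_nhds (by simpa using hJ), ?_⟩, ?_⟩
  · filter_upwards [hmono] with v hv t ht t' ht' hle
    exact hv ht' ht (neg_le_neg hle)
  · have htend : Filter.Tendsto (fun s : ℝ => -s) (𝓝[>] (-p.2)) (𝓝[<] p.2) := by
      simpa using tendsto_neg_nhdsGT (a := -p.2)
    filter_upwards [htend.eventually hint] with s hs
    exact flipTime.continuous.continuousAt.preimage_mem_nhds hs

theorem exists_not_regularAt_mem_closure_laterReach [T2Space E] {x y : E × ℝ} (hZ : IsCompact Z)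
    (hZx : ∀ z ∈ Z, x.2 ≤ z.2) (hreg : ∀ z ∈ Z, z.2 = x.2 → RegularAt Z z) {K : Set (E × ℝ)}
    (hK : IsPreconnected K) (hKZ : K ⊆ Z) (hx : x ∈ K) (hy : y ∈ K) (hxy : x.2 < y.2)
    (hnot : ¬ Reach Z x y) : ∃ p ∈ closure (laterReach Z x), ¬ RegularAt Z p := by
  by_contra! hlimit
  exact hnot (RegularFrom.reach_of_isPreconnected ⟨hZx, hreg, hlimit⟩ hZ hK hKZ hx
    (Reach.refl (hKZ hx)) hy hxy)

end Parametrization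

section Singular

theorem exists_ball_prod_Ioo_subset {E : Type*} [PseudoMetricSpace E] {Z : Set (E × ℝ)} {v : E}
    {s : ℝ} (h : Z ∈ 𝓝 (v, s)) :
    ∃ ρ > 0, Metric.ball v ρ ×ˢ Ioo (s - ρ) (s + ρ) ⊆ Z := by
  obtain ⟨ρ, hρ, hsub⟩ := Metric.mem_nhds_iff.1 h
  refine ⟨ρ, hρ, ?_⟩
  rwa [← Real.ball_eq_Ioo, ball_prod_same]

variable {E : Type*} [NormedAddCommGroup E] [NormedSpace ℝ E] {Z : Set (E × ℝ)} {p x y : E × ℝ}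

theorem OpensAt.eventually_reach (h : OpensAt Z p) (hp : p ∈ closure (laterReach Z x)) :
    ∀ᶠ s in 𝓝[>] p.2, Reach Z x (p.1, s) := by
  obtain ⟨⟨J, hJ, hmono⟩, hint⟩ := h
  obtain ⟨a, b, ⟨hap, hpb⟩, hJ⟩ := mem_nhds_iff_exists_Ioo_subset.1 hJ
  filter_upwards [hint, Ioo_mem_nhdsGT hpb] with s hs ⟨hps, hsb⟩
  obtain ⟨ρ, hρ, hball⟩ := exists_ball_prod_Ioo_subset hs
  obtain ⟨u, hu, hus⟩ : ∃ u, max p.2 (s - ρ) < u ∧ u < s :=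
    exists_between (max_lt hps (sub_lt_self s hρ))
  obtain ⟨hpu, hρu⟩ := max_lt_iff.1 hu
  obtain ⟨r, ⟨⟨hrρ, hrmono⟩, har, hru⟩, -, hxr⟩ := mem_closure_iff_nhds.1 hp _
    (prod_mem_nhds (Filter.inter_mem (Metric.ball_mem_nhds p.1 hρ) hmono) (Ioo_mem_nhds hap hpu))
  have hrmono : MonotoneOn (fun t => (r.1, t) ∈ Z) J := hrmono
  have hvertical : Reach Z r (r.1, u) := reach_of_forall_mem hru.le fun t ht =>
    hrmono (hJ ⟨har, hru.trans (hus.trans hsb)⟩ : r.2 ∈ J)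
      (hJ ⟨har.trans_le ht.1, ht.2.trans_lt (hus.trans hsb)⟩) ht.1 hxr.right_mem
  have hhorizontal : Reach Z (r.1, u) (p.1, s) :=
    reach_of_convex_prod (convex_ball p.1 ρ) hrρ (Metric.mem_ball_self hρ) hus
      ((prod_mono_right (Icc_subset_Ioo hρu (lt_add_of_pos_right s hρ))).trans hball)
  exact (hxr.trans hvertical).trans hhorizontal

theorem ClosesAt.eventually_reach (h : ClosesAt Z p) (hZ : IsCompact Z)
    (hZx : ∀ z ∈ Z, x.2 ≤ z.2) (hxp : x.2 < p.2) (hreg : ∀ z ∈ Z, z ≠ p → RegularAt Z z)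
    (hp : p ∈ closure (laterReach Z x)) : ∀ᶠ s in 𝓝[<] p.2, Reach Z x (p.1, s) := by
  obtain ⟨⟨J, hJ, hmono⟩, hint⟩ := h
  obtain ⟨a, b, ⟨hap, hpb⟩, hJ⟩ := mem_nhds_iff_exists_Ioo_subset.1 hJ
  filter_upwards [hint, Ioo_mem_nhdsLT (max_lt hap hxp)] with s hs ⟨hs', hsp⟩
  obtain ⟨has, hxs⟩ := max_lt_iff.1 hs'
  obtain ⟨ρ, hρ, hball⟩ := exists_ball_prod_Ioo_subset hs
  obtain ⟨r, ⟨⟨hrρ, hrmono⟩, hsr, hrb⟩, ⟨-, hr⟩, hrp⟩ := mem_closure_iff_nhds.1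
    (mem_closure_laterReach_before hZ hZx hxp hreg hp) _
    (prod_mem_nhds (Filter.inter_mem (Metric.ball_mem_nhds p.1 hρ) hmono) (Ioo_mem_nhds hsp hpb))
  have hrmono : AntitoneOn (fun t => (r.1, t) ∈ Z) J := hrmono
  -- Before time `r.2 < p.2` the set `Z` has no singular points, so `K`, which runs down from `r` to
  -- time `s` and then across to the place of `p`, stays within reach of `x`.
  let past : Set (E × ℝ) := Z ∩ Prod.snd ⁻¹' Iic r.2
  let K : Set (E × ℝ) := {r.1} ×ˢ Icc s r.2 ∪ Metric.ball p.1 ρ ×ˢ {s}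
  have hpast : IsCompact past := hZ.inter_right (isClosed_Iic.preimage continuous_snd)
  have hpast_reg : ∀ z ∈ past, RegularAt past z := fun z hz =>
    (hreg z hz.1 (by rintro rfl; exact hz.2.not_gt hrp)).inter_of_ordConnected ordConnected_Iic
  have hfrom : RegularFrom past x :=
    { le_snd := fun z hz => hZx z hz.1
      regularAt_initial := fun z hz _ => hpast_reg z hz
      regularAt_limit := fun z hz =>
        hpast_reg z (closure_minimal laterReach_subset hpast.isClosed hz) }
  have hK : IsPreconnected K :=
    IsPreconnected.union (r.1, s) ⟨rfl, left_mem_Icc.2 hsr.le⟩ ⟨hrρ, rfl⟩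
      (isPreconnected_singleton.prod isPreconnected_Icc)
      ((convex_ball p.1 ρ).isPreconnected.prod isPreconnected_singleton)
  have hKpast : K ⊆ past := by
    rintro ⟨v, t⟩ (⟨rfl, ht⟩ | ⟨hv, rfl⟩)
    · exact ⟨hrmono (hJ ⟨has.trans_le ht.1, ht.2.trans_lt hrb⟩)
        (hJ ⟨has.trans hsr, hrb⟩) ht.2 hr.right_mem, ht.2⟩
    · exact ⟨hball ⟨hv, sub_lt_self _ hρ, lt_add_of_pos_right _ hρ⟩, hsr.le⟩
  exact (hfrom.reach_of_isPreconnected (r := (p.1, s)) hpast hK hKpast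
    (.inl ⟨rfl, right_mem_Icc.2 hsr.le⟩) (hr.mono fun z hz hzt => ⟨hz, hzt.2⟩)
    (.inr ⟨Metric.mem_ball_self hρ, rfl⟩) hxs).mono
    fun z hz _ => hz.1

theorem OpensAt.reach (h : OpensAt Z p) (hZ : IsCompact Z) (hZy : ∀ z ∈ Z, z.2 ≤ y.2)
    (hpy : p.2 < y.2) (hreg : ∀ z ∈ Z, z ≠ p → RegularAt Z z) (hp : p ∈ closure (laterReach Z x))
    (hp' : flipTime p ∈ closure (laterReach (flipTime ⁻¹' Z) (flipTime y))) : Reach Z x y := by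
  have hback : ∀ᶠ s in 𝓝[<] (-p.2), Reach (flipTime ⁻¹' Z) (flipTime y) (p.1, s) :=
    h.flip.eventually_reach (flipTime.isCompact_preimage.2 hZ)
      (fun z hz => neg_le.1 (hZy _ hz)) (neg_lt_neg hpy)
      (fun z hz hzp => regularAt_flipTime_iff.1 (by
        simpa using hreg _ hz fun heq => hzp (by rw [← heq, flipTime_flipTime]))) hp'
  obtain ⟨s, hxs, hys⟩ :=
    ((h.eventually_reach hp).and (tendsto_neg_nhdsGT.eventually hback)).exists
  exact hxs.trans (reach_flipTime_iff.1 hys)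

theorem ClosesAt.reach (h : ClosesAt Z p) (hZ : IsCompact Z) (hZx : ∀ z ∈ Z, x.2 ≤ z.2)
    (hxp : x.2 < p.2) (hreg : ∀ z ∈ Z, z ≠ p → RegularAt Z z) (hp : p ∈ closure (laterReach Z x))
    (hp' : flipTime p ∈ closure (laterReach (flipTime ⁻¹' Z) (flipTime y))) : Reach Z x y := by
  refine reach_flipTime_iff.1 (h.flip.reach (flipTime.isCompact_preimage.2 hZ)
    (fun z hz => le_neg.1 (hZx _ hz)) (neg_lt_neg hxp) (fun z hz hzp => ?_) hp' (by simpa using hp))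
  exact regularAt_flipTime_iff.1 (by
    simpa using hreg _ hz fun heq => hzp (by rw [← heq, flipTime_flipTime]))

theorem reach_of_isPreconnected_of_subsingleton (hZ : IsCompact Z)
    (hZt : ∀ z ∈ Z, z.2 ∈ Icc x.2 y.2) (hxy : x.2 < y.2)
    (hsing : {z ∈ Z | ¬ RegularAt Z z}.Subsingleton)
    (hmodel : ∀ z ∈ Z, ¬ RegularAt Z z → z.2 ∈ Ioo x.2 y.2 ∧ (OpensAt Z z ∨ ClosesAt Z z))
    {K : Set (E × ℝ)} (hK : IsPreconnected K) (hKZ : K ⊆ Z) (hx : x ∈ K) (hy : y ∈ K) :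
    Reach Z x y := by
  by_contra hnot
  have hflip : IsCompact (flipTime ⁻¹' Z) := flipTime.isCompact_preimage.2 hZ
  obtain ⟨p, hp, hpsing⟩ := exists_not_regularAt_mem_closure_laterReach hZ
    (fun z hz => (hZt z hz).1)
    (fun z hz hzx => not_not.1 fun hzsing => (hmodel z hz hzsing).1.1.ne' hzx)
    hK hKZ hx hy hxy hnot
  obtain ⟨q, hq, hqsing⟩ := exists_not_regularAt_mem_closure_laterReach
    (x := flipTime y) (y := flipTime x) hflip
    (fun z hz => neg_le.1 (hZt _ hz).2)
    (fun z hz hzy => regularAt_flipTime_iff.1 (by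
      simpa using not_not.1 fun hzsing => (hmodel _ hz hzsing).1.2.ne (neg_eq_iff_eq_neg.2
        (by simpa using hzy))))
    (flipTime.isPreconnected_preimage.2 hK) (preimage_mono hKZ)
    (by simpa using hy) (by simpa using hx) (neg_lt_neg hxy) (by rwa [reach_flipTime_iff])
  have hpZ : p ∈ Z := closure_minimal laterReach_subset hZ.isClosed hp
  have hqZ : flipTime q ∈ Z := closure_minimal laterReach_subset hflip.isClosed hq
  have hqp : q = flipTime p := by
    rw [hsing ⟨hpZ, hpsing⟩ ⟨hqZ, fun h => hqsing (by simpa using h.flip)⟩, flipTime_flipTime]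
  have hreg : ∀ z ∈ Z, z ≠ p → RegularAt Z z := fun z hz hzp =>
    not_not.1 fun hzsing => hzp (hsing ⟨hz, hzsing⟩ ⟨hpZ, hpsing⟩)
  rw [hqp] at hq
  obtain ⟨⟨hxp, hpy⟩, hopens | hcloses⟩ := hmodel p hpZ hpsing
  · exact hnot (hopens.reach hZ (fun z hz => (hZt z hz).2) hpy hreg hp hq)
  · exact hnot (hcloses.reach hZ (fun z hz => (hZt z hz).1) hxp hreg hp hq)

end Singular

/-! ### Straightening charts -/

section Flat

variable {T : Type*} [NormedAddCommGroup T] [NormedSpace ℝ T] {Z : Set T} {q : T}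

theorem exists_isOpen_inter_eq_image (F : OpenPartialHomeomorph T T) (hq : q ∈ F.source) {K : Set T}
    (hK : Convex ℝ K) (hZ : ∀ᶠ r in 𝓝 q, r ∈ Z ↔ F r ∈ K) {W : Set T} (hW : W ∈ 𝓝 q) :
    ∃ U V, IsOpen U ∧ q ∈ U ∧ U ⊆ W ∧ Convex ℝ V ∧ V ⊆ F.target ∧ U ∩ Z = F.symm '' V := by
  obtain ⟨N, hN, hN_open, hqN⟩ := mem_nhds_iff.1 (Filter.inter_mem hZ hW)
  obtain ⟨ρ, hρ, hball⟩ := Metric.isOpen_iff.1 (F.isOpen_inter_preimage_symm hN_open) (F q)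
    ⟨F.map_source hq, by rwa [mem_preimage, F.left_inv hq]⟩
  let U : Set T := F.source ∩ F ⁻¹' Metric.ball (F q) ρ
  have hUN : U ⊆ N := fun r hr => by
    simpa only [mem_preimage, F.left_inv hr.1] using (hball hr.2).2
  refine ⟨U, K ∩ Metric.ball (F q) ρ, F.isOpen_inter_preimage Metric.isOpen_ball,
    ⟨hq, Metric.mem_ball_self hρ⟩, fun r hr => (hN (hUN hr)).2, hK.inter (convex_ball _ _),
    fun w hw => (hball hw.2).1, Subset.antisymm ?_ ?_⟩
  · rintro r ⟨hr, hrZ⟩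
    exact ⟨F r, ⟨(hN (hUN hr)).1.1 hrZ, hr.2⟩, F.left_inv hr.1⟩
  · rintro _ ⟨w, ⟨hwK, hwb⟩, rfl⟩
    obtain ⟨hwt, hwN⟩ := hball hwb
    exact ⟨⟨F.map_target hwt, by rwa [mem_preimage, F.right_inv hwt]⟩,
      (hN hwN).1.2 (by rwa [F.right_inv hwt])⟩

/-- Near `q`, the set `Z` is homeomorphic to a convex set. -/
def FlatAt (Z : Set T) (q : T) : Prop :=
  ∃ F : OpenPartialHomeomorph T T, q ∈ F.source ∧ ∃ K, Convex ℝ K ∧ ∀ᶠ r in 𝓝 q, r ∈ Z ↔ F r ∈ K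

theorem FlatAt.exists_isPreconnected_inter (h : FlatAt Z q) :
    ∃ U, IsOpen U ∧ q ∈ U ∧ IsPreconnected (U ∩ Z) := by
  obtain ⟨F, hq, K, hK, hZ⟩ := h
  obtain ⟨U, V, hU, hqU, -, hV, hVt, hUZ⟩ :=
    exists_isOpen_inter_eq_image F hq hK hZ Filter.univ_mem
  exact ⟨U, hU, hqU, hUZ ▸ hV.isPreconnected.image _ (F.continuousOn_symm.mono hVt)⟩

theorem locallyPathConnectedSpace_of_flatAt (h : ∀ q ∈ Z, FlatAt Z q) :
    LocallyPathConnectedSpace Z where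
  path_connected_basis := by
    rintro ⟨q, hqZ⟩
    rw [Filter.hasBasis_self]
    intro S hS
    obtain ⟨W, hW, hWS⟩ := mem_nhds_subtype Z _ _ |>.1 hS
    obtain ⟨F, hq, K, hK, hZ⟩ := h q hqZ
    obtain ⟨U, V, hU, hqU, hUW, hV, hVt, hUZ⟩ := exists_isOpen_inter_eq_image F hq hK hZ hW
    refine ⟨Subtype.val ⁻¹' U, (hU.preimage continuous_subtype_val).mem_nhds hqU, ?_,
      (preimage_mono hUW).trans hWS⟩
    rw [Topology.IsInducing.subtypeVal.isPathConnected_iff, Subtype.image_preimage_coe, inter_comm,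
      hUZ]
    have hVne : V.Nonempty := Set.Nonempty.of_image (hUZ ▸ ⟨q, hqU, hqZ⟩ : (F.symm '' V).Nonempty)
    exact (hV.isPathConnected hVne).image' (F.continuousOn_symm.mono hVt)

theorem exists_straightening [CompleteSpace T] {h : T → ℝ} {h' : T →L[ℝ] ℝ} {p : T}
    (hh : HasStrictFDerivAt h h' p) {w : T} (hw : h' w = 1) :
    ∃ F : OpenPartialHomeomorph T T, p ∈ F.source ∧ (∀ r, h' (F r) = h r) ∧
      ∀ r, F r = r + (h r - h' r) • w := by
  have hF : HasStrictFDerivAt (fun r => r + (h r - h' r) • w)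
      ((ContinuousLinearEquiv.refl ℝ T : T ≃L[ℝ] T) : T →L[ℝ] T) p := by
    convert (hasStrictFDerivAt_id p).add ((hh.sub h'.hasStrictFDerivAt).smul_const w) using 1
    · rfl
    · ext v
      simp
  exact ⟨hF.toOpenPartialHomeomorph _, hF.mem_toOpenPartialHomeomorph_source,
    fun r => by simp [hw], fun r => rfl⟩

theorem flatAt_of_hasStrictFDerivAt [CompleteSpace T] {h : T → ℝ} {h' : T →L[ℝ] ℝ}
    (hh : HasStrictFDerivAt h h' q) (hne : h' ≠ 0) {A : Set ℝ} (hA : Convex ℝ A)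
    (hZ : ∀ᶠ r in 𝓝 q, r ∈ Z ↔ h r ∈ A) : FlatAt Z q := by
  obtain ⟨w, hw⟩ := ContinuousLinearMap.exists_ne_zero hne
  obtain ⟨F, hq, hF, -⟩ := exists_straightening hh (w := (h' w)⁻¹ • w)
    (by rw [map_smul, smul_eq_mul, inv_mul_cancel₀ hw])
  exact ⟨F, hq, h' ⁻¹' A, hA.linear_preimage h'.toLinearMap, hZ.mono fun r hr => by simp [hr, hF]⟩

end Flat

section TimeFlat

variable {E : Type*} [NormedAddCommGroup E] [NormedSpace ℝ E] {Z : Set (E × ℝ)} {q : E × ℝ}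

/-- Near `q`, the set `Z` is homeomorphic to a convex set by a time-preserving homeomorphism. -/
def TimeFlatAt (Z : Set (E × ℝ)) (q : E × ℝ) : Prop :=
  ∃ F : OpenPartialHomeomorph (E × ℝ) (E × ℝ), q ∈ F.source ∧ (∀ r, (F r).2 = r.2) ∧
    ∃ K, Convex ℝ K ∧ ∀ᶠ r in 𝓝 q, r ∈ Z ↔ F r ∈ K

theorem TimeFlatAt.flatAt (h : TimeFlatAt Z q) : FlatAt Z q := by
  obtain ⟨F, hq, -, h⟩ := h
  exact ⟨F, hq, h⟩

theorem TimeFlatAt.inter (h : TimeFlatAt Z q) {J : Set ℝ} (hJ : Convex ℝ J) :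
    TimeFlatAt (Z ∩ Prod.snd ⁻¹' J) q := by
  obtain ⟨F, hq, hF, K, hK, h⟩ := h
  refine ⟨F, hq, hF, K ∩ Prod.snd ⁻¹' J,
    hK.inter (hJ.linear_preimage (LinearMap.snd ℝ E ℝ)), h.mono fun r hr => ?_⟩
  simp [hr, hF]

theorem TimeFlatAt.regularAt (h : TimeFlatAt Z q) : RegularAt Z q := by
  obtain ⟨F, hq, hF, K, hK, h⟩ := h
  obtain ⟨U, V, hU, hqU, -, hV, hVt, hUZ⟩ :=
    exists_isOpen_inter_eq_image F hq hK h Filter.univ_mem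
  have hsymm : ∀ w ∈ V, (F.symm w).2 = w.2 := fun w hw => by rw [← hF, F.right_inv (hVt hw)]
  refine ⟨U, hU, hqU, fun r hr r' hr' hlt => ?_⟩
  rw [hUZ] at hr hr'
  obtain ⟨v, hv, rfl⟩ := hr
  obtain ⟨v', hv', rfl⟩ := hr'
  rw [hsymm v hv, hsymm v' hv'] at hlt
  refine reach_of_parametrization hV (F.continuousOn_symm.mono hVt) ?_ hsymm hv hv' hlt
  rw [mapsTo_iff_image_subset, ← hUZ]
  exact inter_subset_right

theorem timeFlatAt_of_mem_iff {J : Set ℝ} (hJ : Convex ℝ J) (h : ∀ᶠ r in 𝓝 q, r ∈ Z ↔ r.2 ∈ J) :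
    TimeFlatAt Z q :=
  ⟨OpenPartialHomeomorph.refl _, mem_univ _, fun _ => rfl, Prod.snd ⁻¹' J,
    hJ.linear_preimage (LinearMap.snd ℝ E ℝ), h⟩

theorem timeFlatAt_of_hasStrictFDerivAt [CompleteSpace E] {h : E × ℝ → ℝ} {h' : E × ℝ →L[ℝ] ℝ}
    (hh : HasStrictFDerivAt h h' q) {v : E} (hv : h' (v, 0) ≠ 0) {A J : Set ℝ} (hA : Convex ℝ A)
    (hJ : Convex ℝ J) (hZ : ∀ᶠ r in 𝓝 q, r ∈ Z ↔ h r ∈ A ∧ r.2 ∈ J) : TimeFlatAt Z q := by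
  have hw : h' ((h' (v, 0))⁻¹ • (v, 0)) = 1 := by
    rw [map_smul, smul_eq_mul, inv_mul_cancel₀ hv]
  obtain ⟨F, hq, hhF, hF⟩ := exists_straightening hh hw
  have hFt : ∀ r, (F r).2 = r.2 := fun r => by simp [hF]
  refine ⟨F, hq, hFt, h' ⁻¹' A ∩ Prod.snd ⁻¹' J,
    (hA.linear_preimage h'.toLinearMap).inter (hJ.linear_preimage (LinearMap.snd ℝ E ℝ)),
    hZ.mono fun r hr => ?_⟩
  simp [hr, hhF, hFt]

theorem opensAt_of_strictMonoOn {E : Type*} [TopologicalSpace E] {Z : Set (E × ℝ)}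
    {h : E × ℝ → ℝ} {p : E × ℝ} (hp : h p = 0) {J : Set ℝ} (hJ : J ∈ 𝓝 p.2)
    (hmono : ∀ᶠ v in 𝓝 p.1, StrictMonoOn (fun t => h (v, t)) J)
    (hcont : ∀ᶠ r in 𝓝 p, ContinuousAt h r) (hZ : ∀ᶠ r in 𝓝 p, r ∈ Z ↔ 0 ≤ h r) :
    OpensAt Z p := by
  constructor
  · obtain ⟨U, hU, J', hJ', hprod⟩ := mem_nhds_prod_iff.1 hZ
    refine ⟨J ∩ J', Filter.inter_mem hJ hJ', ?_⟩
    filter_upwards [hmono, hU] with v hv hvU t ht t' ht' hle hvt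
    exact (hprod ⟨hvU, ht'.2⟩).2
      (((hprod ⟨hvU, ht.2⟩).1 hvt).trans (hv.monotoneOn ht.1 ht'.1 hle))
  · have hline : Filter.Tendsto (fun s => (p.1, s)) (𝓝[>] p.2) (𝓝 p) :=
      ((Continuous.prodMk_right p.1).tendsto p.2).mono_left nhdsWithin_le_nhds
    filter_upwards [hline.eventually (hcont.and hZ.eventually_nhds), self_mem_nhdsWithin,
      nhdsWithin_le_nhds hJ] with s ⟨hs, hZs⟩ hps hsJ
    have hpos : 0 < h (p.1, s) := hp ▸ hmono.self_of_nhds (mem_of_mem_nhds hJ) hsJ hps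
    filter_upwards [hs.eventually (lt_mem_nhds hpos), hZs] with r hr hrZ
    exact hrZ.2 hr.le

theorem exists_strictMonoOn_of_hasStrictFDerivAt {h : E × ℝ → ℝ} {h' : E × ℝ →L[ℝ] ℝ} {p : E × ℝ}
    (hh : HasStrictFDerivAt h h' p) (hpos : 0 < h' (0, 1)) :
    ∃ J ∈ 𝓝 p.2, ∀ᶠ v in 𝓝 p.1, StrictMonoOn (fun t => h (v, t)) J := by
  have hlin := hh.isLittleO.def (c := h' (0, 1) / 2) (by linarith)
  rw [nhds_prod_eq] at hlin
  obtain ⟨W, hW, hlin⟩ := Filter.eventually_prod_self_iff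
    (r := fun a b => ‖h a - h b - h' (a - b)‖ ≤ h' (0, 1) / 2 * ‖a - b‖) |>.1 hlin
  obtain ⟨U, hU, J, hJ, hprod⟩ := mem_nhds_prod_iff.1 hW
  refine ⟨J, hJ, Filter.eventually_of_mem hU fun v hv t ht t' ht' hlt => ?_⟩
  have hdiff : ((v, t') - (v, t) : E × ℝ) = (t' - t) • (0, 1) := by simp
  have hnorm : ‖((v, t') - (v, t) : E × ℝ)‖ = t' - t := by
    simp [Prod.norm_def, abs_of_pos (sub_pos.2 hlt), hlt.le]
  have hbound := hlin (v, t') (hprod ⟨hv, ht'⟩) (v, t) (hprod ⟨hv, ht⟩)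
  rw [hnorm, hdiff, map_smul, smul_eq_mul, Real.norm_eq_abs] at hbound
  change h (v, t) < h (v, t')
  nlinarith [(abs_le.1 hbound).1]

theorem opensAt_of_hasStrictFDerivAt {h : E × ℝ → ℝ} {h' : E × ℝ →L[ℝ] ℝ} {p : E × ℝ}
    (hh : HasStrictFDerivAt h h' p) (hpos : 0 < h' (0, 1)) (hp : h p = 0)
    (hcont : ∀ᶠ r in 𝓝 p, ContinuousAt h r) (hZ : ∀ᶠ r in 𝓝 p, r ∈ Z ↔ 0 ≤ h r) :
    OpensAt Z p := by
  obtain ⟨J, hJ, hmono⟩ := exists_strictMonoOn_of_hasStrictFDerivAt hh hpos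
  exact opensAt_of_strictMonoOn hp hJ hmono hcont hZ

theorem closesAt_of_hasStrictFDerivAt {h : E × ℝ → ℝ} {h' : E × ℝ →L[ℝ] ℝ} {p : E × ℝ}
    (hh : HasStrictFDerivAt h h' p) (hneg : h' (0, 1) < 0) (hp : h p = 0)
    (hcont : ∀ᶠ r in 𝓝 p, ContinuousAt h r) (hZ : ∀ᶠ r in 𝓝 p, r ∈ Z ↔ 0 ≤ h r) :
    ClosesAt Z p := by
  let φ : (E × ℝ) →L[ℝ] (E × ℝ) :=
    (ContinuousLinearMap.fst ℝ E ℝ).prod (-ContinuousLinearMap.snd ℝ E ℝ)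
  have hflip : Filter.Tendsto φ (𝓝 (flipTime p)) (𝓝 p) :=
    φ.continuous.tendsto' _ _ (flipTime_flipTime p)
  have hh' : HasStrictFDerivAt h h' (φ (flipTime p)) := by
    rwa [show φ (flipTime p) = p from flipTime_flipTime p]
  have hopens : OpensAt (flipTime ⁻¹' Z) (flipTime p) := by
    refine opensAt_of_hasStrictFDerivAt (hh'.comp _ φ.hasStrictFDerivAt) ?_ ?_ ?_
      (hflip.eventually hZ)
    · have hφ : φ (0, 1) = -(0, 1) := by simp [φ]
      rw [ContinuousLinearMap.comp_apply, hφ, map_neg]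
      exact neg_pos.2 hneg
    · rwa [show φ (flipTime p) = p from flipTime_flipTime p]
    · filter_upwards [hflip.eventually hcont] with r hr
      exact hr.comp φ.continuous.continuousAt
  simpa using hopens.flip

end TimeFlat

/-! ### Local models of covered regions -/

section Quadrant

variable {V : Type*} [NormedAddCommGroup V] [NormedSpace ℝ V]
  {a ℓ : V →L[ℝ] ℝ} {u y₀ : V} {T : V → ℝ} {T' : V →L[ℝ] ℝ}

theorem mem_posTangentConeAt_of_forall_pos {S : Set V} {x w : V}
    (h : ∀ s : ℝ, 0 < s → x + s • w ∈ S) : w ∈ posTangentConeAt S x :=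
  mem_posTangentConeAt_of_frequently_mem
    (Filter.eventually_of_mem (U := Ioi (0 : ℝ)) self_mem_nhdsWithin h).frequently

theorem eq_smul_of_eventually_eq_zero (hau : a u = 1) (ha₀ : a y₀ = 0) (hℓ₀ : ℓ y₀ = 0)
    (hT : HasFDerivAt T T' y₀) (h : ∀ᶠ y in 𝓝 y₀, 0 ≤ ℓ y → a y = 0 → T y = 0) :
    T' = T' u • a := by
  let S : Set V := {y | 0 ≤ ℓ y ∧ a y = 0}
  have hconst : ∀ᶠ y in 𝓝[S] y₀, T y = T y₀ := by
    filter_upwards [nhdsWithin_le_nhds h, self_mem_nhdsWithin] with y hy hyS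
    rw [hy hyS.1 hyS.2, h.self_of_nhds hℓ₀.ge ha₀]
  have hmin : IsLocalMinOn T S y₀ := hconst.mono fun y hy => hy.ge
  have hmax : IsLocalMaxOn T S y₀ := hconst.mono fun y hy => hy.le
  have hcone : ∀ w, a w = 0 → 0 ≤ ℓ w → w ∈ posTangentConeAt S y₀ := fun w haw hℓw =>
    mem_posTangentConeAt_of_forall_pos fun s hs => by
      simp only [S, mem_ofPred_eq, map_add, map_smul, ha₀, hℓ₀, haw, smul_eq_mul]
      exact ⟨by positivity, by simp⟩
  have hzero : ∀ w, a w = 0 → 0 ≤ ℓ w → T' w = 0 := fun w haw hℓw =>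
    le_antisymm (hmax.hasFDerivWithinAt_nonpos hT.hasFDerivWithinAt (hcone w haw hℓw))
      (hmin.hasFDerivWithinAt_nonneg hT.hasFDerivWithinAt (hcone w haw hℓw))
  have hker : ∀ w, a w = 0 → T' w = 0 := fun w haw => by
    rcases le_total 0 (ℓ w) with hℓw | hℓw
    · exact hzero w haw hℓw
    · simpa using hzero (-w) (by simp [haw]) (by simpa using hℓw)
  ext w
  have hw := hker (w - a w • u) (by simp [hau])
  simp only [map_sub, map_smul, smul_eq_mul] at hw
  simp only [FunLike.coe_smul, Pi.smul_apply, smul_eq_mul]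
  linarith

theorem eventually_abs_sub_le_mul_abs (hau : a u = 1) (hℓu : ℓ u = 0) (ha₀ : a y₀ = 0)
    (hT : HasStrictFDerivAt T T' y₀) (h : ∀ᶠ y in 𝓝 y₀, 0 ≤ ℓ y → a y = 0 → T y = 0)
    {ε : ℝ} (hε : 0 < ε) : ∀ᶠ y in 𝓝 y₀, 0 ≤ ℓ y → |T y - T' u * a y| ≤ ε * |a y| := by
  have hu : 0 < ‖u‖ := norm_pos_iff.2 (by rintro rfl; simp at hau)
  have hproj : Filter.Tendsto (fun y => (y, y - a y • u)) (𝓝 y₀) (𝓝 (y₀, y₀)) := by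
    have hcont : Continuous fun y => (y, y - a y • u) := by fun_prop
    simpa [ha₀] using hcont.tendsto y₀
  have hstrict := hproj.eventually (hT.isLittleO.def (div_pos hε hu))
  have hface := ((continuous_snd.tendsto (y₀, y₀)).comp hproj).eventually h
  filter_upwards [hstrict, hface] with y hy hy₀ hℓy
  have hTz : T (y - a y • u) = 0 := hy₀ (by simpa [hℓu] using hℓy) (by simp [hau])
  calc |T y - T' u * a y| = ‖T y - T (y - a y • u) - T' (y - (y - a y • u))‖ := by
        rw [hTz, sub_sub_cancel, map_smul, smul_eq_mul, Real.norm_eq_abs, sub_zero, mul_comm]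
    _ ≤ ε / ‖u‖ * ‖y - (y - a y • u)‖ := hy
    _ = ε * |a y| := by
        rw [sub_sub_cancel, norm_smul, Real.norm_eq_abs]
        field_simp

theorem nonneg_iff_nonneg_of_abs_sub_le {c x y : ℝ} (hc : 0 < c) (h : |y - c * x| ≤ c / 2 * |x|) :
    0 ≤ y ↔ 0 ≤ x := by
  rw [abs_le] at h
  rcases le_or_gt 0 x with hx | hx
  · rw [abs_of_nonneg hx] at h
    exact iff_of_true (by nlinarith) hx
  · rw [abs_of_neg hx] at h
    exact iff_of_false (by nlinarith) hx.not_ge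

theorem exists_pos_smul_and_sign_iff (hau : a u = 1) (hℓu : ℓ u = 0) (ha₀ : a y₀ = 0)
    (hℓ₀ : ℓ y₀ = 0) (hT : HasStrictFDerivAt T T' y₀) (hT' : T' ≠ 0)
    (h : ∀ᶠ y in 𝓝 y₀, 0 ≤ ℓ y → 0 ≤ a y → 0 ≤ T y ∧ (a y = 0 → T y = 0)) :
    ∃ c : ℝ, 0 < c ∧ T' = c • a ∧ ∀ᶠ y in 𝓝 y₀, 0 ≤ ℓ y → (0 ≤ T y ↔ 0 ≤ a y) := by
  have hface : ∀ᶠ y in 𝓝 y₀, 0 ≤ ℓ y → a y = 0 → T y = 0 :=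
    h.mono fun y hy hℓy hay => (hy hℓy hay.ge).2 hay
  have hsmul := eq_smul_of_eventually_eq_zero hau ha₀ hℓ₀ hT.hasFDerivAt hface
  have hmin : IsLocalMinOn T {y | 0 ≤ ℓ y ∧ 0 ≤ a y} y₀ := by
    filter_upwards [nhdsWithin_le_nhds h, self_mem_nhdsWithin] with y hy hyS
    rw [hface.self_of_nhds hℓ₀.ge ha₀]
    exact (hy hyS.1 hyS.2).1
  have hcone : u ∈ posTangentConeAt {y | 0 ≤ ℓ y ∧ 0 ≤ a y} y₀ :=
    mem_posTangentConeAt_of_forall_pos fun s hs => by simp [ha₀, hℓ₀, hau, hℓu, hs.le]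
  have hne : T' u ≠ 0 := fun h0 => hT' (by rw [hsmul, h0, zero_smul])
  have hpos : 0 < T' u :=
    (hmin.hasFDerivWithinAt_nonneg hT.hasFDerivAt.hasFDerivWithinAt hcone).lt_of_ne' hne
  refine ⟨T' u, hpos, hsmul, ?_⟩
  filter_upwards [eventually_abs_sub_le_mul_abs hau hℓu ha₀ hT hface (half_pos hpos)]
    with y hy hℓy
  exact nonneg_iff_nonneg_of_abs_sub_le hpos (hy hℓy)

end Quadrant

theorem fderiv_symm_comp_fderiv {V W : Type*} [NormedAddCommGroup V] [NormedSpace ℝ V]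
    [NormedAddCommGroup W] [NormedSpace ℝ W] (e : OpenPartialHomeomorph V W) {p : V}
    (hp : p ∈ e.source) (he : DifferentiableAt ℝ e p) (he' : DifferentiableAt ℝ e.symm (e p)) :
    (fderiv ℝ e.symm (e p)).comp (fderiv ℝ e p) = ContinuousLinearMap.id ℝ V := by
  rw [← fderiv_comp p he' he]
  exact (Filter.EventuallyEq.fderiv_eq (e.eventually_left_inverse hp)).trans fderiv_id

section Chart

variable {d : ℕ} {e : OpenPartialHomeomorph (SpaceTime d) (Space (d + 1))} {p : SpaceTime d}

theorem IsSmoothChart.contDiffAt (he : IsSmoothChart e) (hp : p ∈ e.source) :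
    ContDiffAt ℝ 1 e p :=
  (he.1.contDiffAt (e.open_source.mem_nhds hp)).of_le (by simp)

theorem IsSmoothChart.contDiffAt_symm (he : IsSmoothChart e) (hp : p ∈ e.source) :
    ContDiffAt ℝ 1 e.symm (e p) :=
  (he.2.contDiffAt (e.open_target.mem_nhds (e.map_source hp))).of_le (by simp)

theorem IsSmoothChart.fderiv_symm_fderiv (he : IsSmoothChart e) (hp : p ∈ e.source)
    (w : SpaceTime d) : fderiv ℝ e.symm (e p) (fderiv ℝ e p w) = w :=
  congrArg (· w) (fderiv_symm_comp_fderiv e hp ((he.contDiffAt hp).differentiableAt one_ne_zero)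
    ((he.contDiffAt_symm hp).differentiableAt one_ne_zero))

theorem IsSmoothChart.fderiv_fderiv_symm (he : IsSmoothChart e) (hp : p ∈ e.source)
    (w : Space (d + 1)) : fderiv ℝ e p (fderiv ℝ e.symm (e p) w) = w := by
  have hcomp := fderiv_symm_comp_fderiv e.symm (e.map_source hp)
    ((he.contDiffAt_symm hp).differentiableAt one_ne_zero)
    (by simpa [hp] using (he.contDiffAt hp).differentiableAt one_ne_zero)
  rw [e.symm_symm, e.left_inv hp] at hcomp
  exact congrArg (· w) hcomp

theorem IsSmoothChart.contDiffAt_coord (he : IsSmoothChart e) (hp : p ∈ e.source)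
    (i : Fin (d + 1)) : ContDiffAt ℝ 1 (fun r => e r i) p :=
  (EuclideanSpace.proj (𝕜 := ℝ) i).contDiff.contDiffAt.comp p (he.contDiffAt hp)

theorem IsSmoothChart.fderiv_coord (he : IsSmoothChart e) (hp : p ∈ e.source)
    (i : Fin (d + 1)) (w : SpaceTime d) :
    fderiv ℝ (fun r => e r i) p w = (fderiv ℝ e p w) i :=
  congrArg (· w) ((EuclideanSpace.proj (𝕜 := ℝ) i : Space (d + 1) →L[ℝ] ℝ).hasFDerivAt.comp p
    ((he.contDiffAt hp).differentiableAt one_ne_zero).hasFDerivAt).fderiv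

theorem IsSmoothChart.fderiv_coord_symm_single (he : IsSmoothChart e) (hp : p ∈ e.source)
    (i : Fin (d + 1)) :
    fderiv ℝ (fun r => e r i) p (fderiv ℝ e.symm (e p) (EuclideanSpace.single i 1)) = 1 := by
  rw [he.fderiv_coord hp, he.fderiv_fderiv_symm hp]
  simp

theorem IsSmoothChart.sign_iff (he : IsSmoothChart e) (hp : p ∈ e.source)
    {ℓ : Space (d + 1) →L[ℝ] ℝ} (hℓ : ℓ (EuclideanSpace.single 0 1) = 0) (h0 : e p 0 = 0)
    (hℓ0 : ℓ (e p) = 0) {τ : SpaceTime d → ℝ} {τ' : SpaceTime d →L[ℝ] ℝ}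
    (hτ : HasStrictFDerivAt τ τ' p) (hτ' : τ' ≠ 0)
    (h : ∀ r ∈ e.source, 0 ≤ ℓ (e r) → 0 ≤ e r 0 → 0 ≤ τ r ∧ (e r 0 = 0 → τ r = 0)) :
    (∃ c : ℝ, ∀ w, τ' (fderiv ℝ e.symm (e p) w) = c * w 0) ∧
      ∀ᶠ r in 𝓝 p, 0 ≤ ℓ (e r) → (0 ≤ τ r ↔ 0 ≤ e r 0) := by
  have hstrict : HasStrictFDerivAt (τ ∘ e.symm) (τ'.comp (fderiv ℝ e.symm (e p))) (e p) := by
    refine HasStrictFDerivAt.comp (e p) ?_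
      ((he.contDiffAt_symm hp).hasStrictFDerivAt one_ne_zero)
    rwa [e.left_inv hp]
  have hne : τ'.comp (fderiv ℝ e.symm (e p)) ≠ 0 := fun hzero => hτ' <| by
    refine ContinuousLinearMap.ext fun w => ?_
    rw [← he.fderiv_symm_fderiv hp w]
    exact congrArg (· (fderiv ℝ e p w)) hzero
  obtain ⟨c, -, hsmul, hsign⟩ := exists_pos_smul_and_sign_iff
    (a := EuclideanSpace.proj (𝕜 := ℝ) (0 : Fin (d + 1))) (u := EuclideanSpace.single 0 1)
    (by simp) hℓ h0 hℓ0 hstrict hne (by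
      filter_upwards [e.open_target.mem_nhds (e.map_source hp)] with y hy
      simpa [e.right_inv hy] using h (e.symm y) (e.map_target hy))
  refine ⟨⟨c, fun w => by simpa using congrArg (· w) hsmul⟩, ?_⟩
  filter_upwards [(e.continuousAt hp).eventually hsign, e.open_source.mem_nhds hp] with r hr hrs
  simpa [e.left_inv hrs] using hr

variable {M F G : Set (SpaceTime d)}

theorem IsFacePoint.exists_function (h : IsFacePoint M F p) :
    ∃ h : SpaceTime d → ℝ, ContDiffAt ℝ 1 h p ∧ fderiv ℝ h p ≠ 0 ∧
      ∀ᶠ r in 𝓝 p, (r ∈ M ↔ 0 ≤ h r) ∧ (r ∈ F ↔ h r = 0) := by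
  obtain ⟨e, he, hp, -, hM, hF⟩ := h
  refine ⟨fun r => e r 0, he.contDiffAt_coord hp 0, fun h0 => ?_, ?_⟩
  · simpa [h0] using he.fderiv_coord_symm_single hp 0
  · filter_upwards [e.open_source.mem_nhds hp] with r hr
    exact ⟨by simpa [hr] using Set.ext_iff.1 hM r, by simpa [hr] using Set.ext_iff.1 hF r⟩

theorem IsFacePoint.eventually_mem (h : IsFacePoint M F p) {τ : SpaceTime d → ℝ}
    {τ' : SpaceTime d →L[ℝ] ℝ} (hτ : HasStrictFDerivAt τ τ' p) (hτ' : τ' ≠ 0)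
    (hM : ∀ r ∈ M, 0 ≤ τ r) (hF : ∀ r ∈ F, τ r = 0) : ∀ᶠ r in 𝓝 p, 0 ≤ τ r → r ∈ M := by
  obtain ⟨e, he, hp, h0, hMe, hFe⟩ := h
  have hM_iff : ∀ r ∈ e.source, (r ∈ M ↔ 0 ≤ e r 0) := fun r hr => by
    simpa [hr] using Set.ext_iff.1 hMe r
  have hF_iff : ∀ r ∈ e.source, (r ∈ F ↔ e r 0 = 0) := fun r hr => by
    simpa [hr] using Set.ext_iff.1 hFe r
  obtain ⟨-, hsign⟩ := he.sign_iff hp (ℓ := 0) (by simp) h0 (by simp) hτ hτ' fun r hr _ hr0 =>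
    ⟨hM r ((hM_iff r hr).2 hr0), fun h => hF r ((hF_iff r hr).2 h)⟩
  filter_upwards [hsign, e.open_source.mem_nhds hp] with r hr hrs hτr
  exact (hM_iff r hrs).2 ((hr (by simp)).1 hτr)

theorem IsCornerPoint.exists_function (hd : d ≠ 0) (h : IsCornerPoint M F G p)
    {τ : SpaceTime d → ℝ} {τ' : SpaceTime d →L[ℝ] ℝ} (hτ : HasStrictFDerivAt τ τ' p)
    (hτ' : τ' ≠ 0) (hM : ∀ r ∈ M, 0 ≤ τ r) (hF : ∀ r ∈ F, τ r = 0) :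
    ∃ h : SpaceTime d → ℝ, ContDiffAt ℝ 1 h p ∧ (∃ w, τ' w = 0 ∧ fderiv ℝ h p w ≠ 0) ∧
      ∀ᶠ r in 𝓝 p, (r ∈ M ↔ 0 ≤ h r ∧ 0 ≤ τ r) ∧ (r ∈ G ↔ h r = 0 ∧ 0 ≤ τ r) := by
  obtain ⟨e, he, hp, h0, h1, hMe, hFe, hGe⟩ := h
  have h01 : (0 : Fin (d + 1)) ≠ 1 := by
    obtain ⟨k, rfl⟩ := Nat.exists_eq_succ_of_ne_zero hd
    exact (Fin.succ_ne_zero (0 : Fin (k + 1))).symm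
  have hM_iff : ∀ r ∈ e.source, (r ∈ M ↔ 0 ≤ e r 0 ∧ 0 ≤ e r 1) := fun r hr => by
    simpa [hr] using Set.ext_iff.1 hMe r
  have hF_iff : ∀ r ∈ e.source, (r ∈ F ↔ e r 0 = 0 ∧ 0 ≤ e r 1) := fun r hr => by
    simpa [hr] using Set.ext_iff.1 hFe r
  have hG_iff : ∀ r ∈ e.source, (r ∈ G ↔ 0 ≤ e r 0 ∧ e r 1 = 0) := fun r hr => by
    simpa [hr] using Set.ext_iff.1 hGe r
  obtain ⟨⟨c, hc⟩, hsign⟩ := he.sign_iff hp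
    (ℓ := EuclideanSpace.proj (𝕜 := ℝ) (1 : Fin (d + 1))) (by simp [h01.symm]) h0
    (by simpa using h1) hτ hτ' fun r hr (hr1 : 0 ≤ e r 1) hr0 =>
      ⟨hM r ((hM_iff r hr).2 ⟨hr0, hr1⟩), fun h => hF r ((hF_iff r hr).2 ⟨h, hr1⟩)⟩
  refine ⟨fun r => e r 1, he.contDiffAt_coord hp 1,
    ⟨fderiv ℝ e.symm (e p) (EuclideanSpace.single 1 1), ?_, ?_⟩, ?_⟩
  · simp [hc, h01]
  · rw [he.fderiv_coord_symm_single hp]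
    exact one_ne_zero
  · filter_upwards [hsign, e.open_source.mem_nhds hp] with r (hr : 0 ≤ e r 1 → _) hrs
    rw [hM_iff r hrs, hG_iff r hrs]
    exact ⟨by rw [and_comm, and_congr_right fun h => (hr h).symm],
      by rw [and_comm, and_congr_right fun h => (hr h.ge).symm]⟩

end Chart

section TimeLevel

variable {d : ℕ} {M G : Set (SpaceTime d)} {p : SpaceTime d} {σ c : ℝ}

theorem hasStrictFDerivAt_mul_snd_sub (σ c : ℝ) (p : SpaceTime d) :
    HasStrictFDerivAt (fun r : SpaceTime d => σ * (r.2 - c))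
      (σ • ContinuousLinearMap.snd ℝ (Space d) ℝ) p :=
  (hasStrictFDerivAt_snd.sub_const c).const_mul σ

theorem smul_snd_ne_zero (hσ : σ ≠ 0) : σ • ContinuousLinearMap.snd ℝ (Space d) ℝ ≠ 0 :=
  fun h => hσ (by simpa using congrArg (· (0, 1)) h)

theorem IsFacePoint.eventually_mem_of_levelSet (h : IsFacePoint M (levelSet M c) p) (hσ : σ ≠ 0)
    (hM : ∀ r ∈ M, 0 ≤ σ * (r.2 - c)) : ∀ᶠ r in 𝓝 p, 0 ≤ σ * (r.2 - c) → r ∈ M :=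
  h.eventually_mem (hasStrictFDerivAt_mul_snd_sub σ c p) (smul_snd_ne_zero hσ) hM
    fun _ hr => by rw [hr.2, sub_self, mul_zero]

theorem IsCornerPoint.exists_function_of_levelSet (hd : d ≠ 0)
    (h : IsCornerPoint M (levelSet M c) G p) (hσ : σ ≠ 0) (hM : ∀ r ∈ M, 0 ≤ σ * (r.2 - c)) :
    ∃ h : SpaceTime d → ℝ, ContDiffAt ℝ 1 h p ∧ (∃ v, fderiv ℝ h p (v, 0) ≠ 0) ∧
      ∀ᶠ r in 𝓝 p, (r ∈ M ↔ 0 ≤ h r ∧ 0 ≤ σ * (r.2 - c)) ∧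
        (r ∈ G ↔ h r = 0 ∧ 0 ≤ σ * (r.2 - c)) := by
  obtain ⟨h, hh, ⟨⟨v, t⟩, ht, hv⟩, hev⟩ := h.exists_function hd
    (hasStrictFDerivAt_mul_snd_sub σ c p) (smul_snd_ne_zero hσ) hM
    fun _ hr => by rw [hr.2, sub_self, mul_zero]
  obtain rfl : t = 0 := by simpa [hσ] using ht
  exact ⟨h, hh, ⟨v, hv⟩, hev⟩

end TimeLevel

section DefiningFunction

theorem exists_horizontal_of_ne_zero {E : Type*} [NormedAddCommGroup E] [NormedSpace ℝ E]
    {L : E × ℝ →L[ℝ] ℝ} (hL : L ≠ 0) (h0 : L (0, 1) = 0) : ∃ v, L (v, 0) ≠ 0 := by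
  obtain ⟨w, hw⟩ := ContinuousLinearMap.exists_ne_zero hL
  refine ⟨w.1, fun h => hw ?_⟩
  rw [show w = (w.1, 0) + w.2 • (0, 1) by ext <;> simp, map_add, map_smul, h, h0, smul_zero,
    add_zero]

variable {d : ℕ} {M G : Set (SpaceTime d)} {h : SpaceTime d → ℝ} {p : SpaceTime d}

/-- Near `p`, the function `h` cuts out the region `M` over the time interval `[0, 1]` as `0 ≤ h`,
and its side boundary `G` as `h = 0`. At times `0` and `1` the zero set of `h` is required to be
transverse to the time slices. -/
structure IsDefiningFunction (M G : Set (SpaceTime d)) (h : SpaceTime d → ℝ) (p : SpaceTime d) :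
    Prop where
  contDiffAt : ContDiffAt ℝ 1 h p
  fderiv_ne_zero : fderiv ℝ h p ≠ 0
  mem_Ioo_or : p.2 ∈ Ioo (0 : ℝ) 1 ∨ ∃ v, fderiv ℝ h p (v, 0) ≠ 0
  eventually_mem_iff : ∀ᶠ r in 𝓝 p, r ∈ M ↔ 0 ≤ h r ∧ r.2 ∈ Icc (0 : ℝ) 1
  eventually_mem_side_iff : ∀ᶠ r in 𝓝 p, r ∈ G ↔ h r = 0 ∧ r.2 ∈ Icc (0 : ℝ) 1

theorem eventually_snd_mem {s : Set ℝ} (hs : s ∈ 𝓝 p.2) : ∀ᶠ r in 𝓝 p, r.2 ∈ s :=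
  continuous_snd.continuousAt.eventually hs

theorem IsFacePoint.exists_isDefiningFunction (hf : IsFacePoint M G p) (hp : p.2 ∈ Ioo (0 : ℝ) 1) :
    ∃ h, IsDefiningFunction M G h p := by
  obtain ⟨h, hh, hne, hev⟩ := hf.exists_function
  have hIcc := eventually_snd_mem (Icc_mem_nhds hp.1 hp.2)
  exact ⟨h, hh, hne, .inl hp, (hev.and hIcc).mono fun r hr => by rw [hr.1.1, and_iff_left hr.2],
    (hev.and hIcc).mono fun r hr => by rw [hr.1.2, and_iff_left hr.2]⟩

theorem IsCornerPoint.exists_isDefiningFunction (hd : d ≠ 0) {c σ : ℝ}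
    (hc : IsCornerPoint M (levelSet M c) G p) (hσ : σ ≠ 0) (hM : ∀ r ∈ M, 0 ≤ σ * (r.2 - c))
    (hI : ∀ᶠ t in 𝓝 p.2, 0 ≤ σ * (t - c) ↔ t ∈ Icc (0 : ℝ) 1) :
    ∃ h, IsDefiningFunction M G h p := by
  obtain ⟨h, hh, hv, hev⟩ := hc.exists_function_of_levelSet hd hσ hM
  have hne : fderiv ℝ h p ≠ 0 := fun h0 => by simp [h0] at hv
  have hI' := continuous_snd.continuousAt.eventually hI
  exact ⟨h, hh, hne, .inr hv, (hev.and hI').mono fun r hr => by rw [hr.1.1, hr.2],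
    (hev.and hI').mono fun r hr => by rw [hr.1.2, hr.2]⟩

namespace IsDefiningFunction

theorem hasStrictFDerivAt (hh : IsDefiningFunction M G h p) :
    HasStrictFDerivAt h (fderiv ℝ h p) p :=
  hh.contDiffAt.hasStrictFDerivAt one_ne_zero

theorem apply_eq_zero (hh : IsDefiningFunction M G h p) (hp : p ∈ G) : h p = 0 :=
  (hh.eventually_mem_side_iff.self_of_nhds.1 hp).1

theorem timeFlatAt (hh : IsDefiningFunction M G h p) {v : Space d} (hv : fderiv ℝ h p (v, 0) ≠ 0) :
    TimeFlatAt M p :=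
  timeFlatAt_of_hasStrictFDerivAt hh.hasStrictFDerivAt hv (convex_Ici 0) (convex_Icc 0 1)
    hh.eventually_mem_iff

theorem timeFlatAt_side (hh : IsDefiningFunction M G h p) {v : Space d}
    (hv : fderiv ℝ h p (v, 0) ≠ 0) : TimeFlatAt G p :=
  timeFlatAt_of_hasStrictFDerivAt hh.hasStrictFDerivAt hv (convex_singleton 0) (convex_Icc 0 1)
    hh.eventually_mem_side_iff

theorem timeFlatAt_diff (hh : IsDefiningFunction M G h p) {v : Space d}
    (hv : fderiv ℝ h p (v, 0) ≠ 0) : TimeFlatAt (Prod.snd ⁻¹' Icc (0 : ℝ) 1 \ M) p := by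
  refine timeFlatAt_of_hasStrictFDerivAt hh.hasStrictFDerivAt hv (convex_Iio 0) (convex_Icc 0 1)
    (hh.eventually_mem_iff.mono fun r hr => ?_)
  rw [mem_sdiff, mem_preimage, hr, mem_Iio, ← not_le]
  tauto

theorem flatAt_side (hh : IsDefiningFunction M G h p) : FlatAt G p := by
  rcases hh.mem_Ioo_or with hp | ⟨v, hv⟩
  · refine flatAt_of_hasStrictFDerivAt hh.hasStrictFDerivAt hh.fderiv_ne_zero
      (convex_singleton (0 : ℝ)) ?_
    filter_upwards [hh.eventually_mem_side_iff, eventually_snd_mem (Icc_mem_nhds hp.1 hp.2)]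
      with r hr hrI
    rw [hr, and_iff_left hrI, mem_singleton_iff]
  · exact (hh.timeFlatAt_side hv).flatAt

theorem fderiv_time_ne_zero (hh : IsDefiningFunction M G h p)
    (hz : ∀ v, fderiv ℝ h p (v, 0) = 0) : fderiv ℝ h p (0, 1) ≠ 0 := fun h0 =>
  have ⟨v, hv⟩ := exists_horizontal_of_ne_zero hh.fderiv_ne_zero h0
  hv (hz v)

theorem isCriticalPoint (hh : IsDefiningFunction M G h p) (hp : p ∈ G)
    (hz : ∀ v, fderiv ℝ h p (v, 0) = 0) : IsCriticalPoint G p := by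
  have htangent : ∀ w ∈ tangentConeAt ℝ G p, fderiv ℝ h p w = 0 := fun w hw => by
    have hzero : HasFDerivWithinAt h (0 : SpaceTime d →L[ℝ] ℝ) G p := by
      refine (hasFDerivWithinAt_const (0 : ℝ) p G).congr_of_eventuallyEq ?_ (hh.apply_eq_zero hp)
      filter_upwards [nhdsWithin_le_nhds hh.eventually_mem_side_iff, self_mem_nhdsWithin]
        with r hr hrG
      exact (hr.1 hrG).1
    exact hh.hasStrictFDerivAt.hasFDerivAt.hasFDerivWithinAt.unique_on hzero hw
  refine ⟨hp, fun w hw => ?_⟩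
  have hw0 := htangent w hw
  rw [show w = (w.1, 0) + w.2 • (0, 1) by ext <;> simp, map_add, map_smul, hz, zero_add,
    smul_eq_mul] at hw0
  exact (mul_eq_zero.1 hw0).resolve_right (hh.fderiv_time_ne_zero hz)

theorem opensAt_or_closesAt (hh : IsDefiningFunction M G h p) (hp : p ∈ G)
    (hz : ∀ v, fderiv ℝ h p (v, 0) = 0) : OpensAt M p ∨ ClosesAt M p := by
  have hpI : p.2 ∈ Ioo (0 : ℝ) 1 := hh.mem_Ioo_or.resolve_right fun ⟨v, hv⟩ => hv (hz v)
  have hcont : ∀ᶠ r in 𝓝 p, ContinuousAt h r :=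
    (hh.contDiffAt.eventually (by simp)).mono fun _ hr => hr.continuousAt
  have hM : ∀ᶠ r in 𝓝 p, r ∈ M ↔ 0 ≤ h r := by
    filter_upwards [hh.eventually_mem_iff, eventually_snd_mem (Icc_mem_nhds hpI.1 hpI.2)]
      with r hr hrI
    rw [hr, and_iff_left hrI]
  rcases (hh.fderiv_time_ne_zero hz).lt_or_gt with hneg | hpos
  · exact .inr (closesAt_of_hasStrictFDerivAt hh.hasStrictFDerivAt hneg (hh.apply_eq_zero hp)
      hcont hM)
  · exact .inl (opensAt_of_hasStrictFDerivAt hh.hasStrictFDerivAt hpos (hh.apply_eq_zero hp)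
      hcont hM)

theorem exists_horizontal_of_forall_mem (hh : IsDefiningFunction M G h p)
    (hG : ∀ t ∈ Icc (0 : ℝ) 1, (p.1, t) ∈ G) : ∃ v, fderiv ℝ h p (v, 0) ≠ 0 := by
  refine hh.mem_Ioo_or.elim (fun hp => exists_horizontal_of_ne_zero hh.fderiv_ne_zero ?_) id
  have hderiv : HasDerivAt (h ∘ fun t : ℝ => (p.1, t)) (fderiv ℝ h p (0, 1)) p.2 :=
    hh.hasStrictFDerivAt.hasFDerivAt.comp_hasDerivAt p.2
      ((hasDerivAt_const p.2 p.1).prodMk (hasDerivAt_id p.2))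
  have hzero : HasDerivAt (h ∘ fun t : ℝ => (p.1, t)) 0 p.2 := by
    refine (hasDerivAt_const p.2 (0 : ℝ)).congr_of_eventuallyEq ?_
    filter_upwards [((Continuous.prodMk_right p.1).tendsto p.2).eventually
      hh.eventually_mem_side_iff, Icc_mem_nhds hp.1 hp.2] with t ht htI
    exact (ht.1 (hG t htI)).1
  exact hderiv.unique hzero

end IsDefiningFunction

end DefiningFunction

/-! ### Geometry of covered regions -/

section CoveredRegion

variable {d : ℕ} {D : Set (Space d)} {C N : Set (SpaceTime d)} {p : SpaceTime d}

theorem IsSmoothBall.isCompact (hD : IsSmoothBall D) : IsCompact D := by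
  obtain ⟨φ, hφ, -, -, rfl⟩ := hD
  exact (isCompact_closedBall _ _).image hφ.continuous

theorem isClosed_wall (D : Set (Space d)) : IsClosed (frontier D ×ˢ Icc (0 : ℝ) 1) :=
  isClosed_frontier.prod isClosed_Icc

namespace IsCoveredRegion

theorem isClosed (hC : IsCoveredRegion D C N) : IsClosed C :=
  hC.isCobordism.isCompact.isClosed

theorem snd_mem (hC : IsCoveredRegion D C N) (hp : p ∈ C) : p.2 ∈ Icc (0 : ℝ) 1 :=
  (hC.subset hp).2

theorem side_subset (hC : IsCoveredRegion D C N) : N ⊆ C := by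
  refine Subset.trans ?_ hC.isClosed.frontier_subset
  rw [hC.isCobordism.boundary_eq]
  exact subset_union_right.trans subset_union_left

theorem wall_subset (hC : IsCoveredRegion D C N) : frontier D ×ˢ Icc (0 : ℝ) 1 ⊆ N := by
  obtain ⟨p, -, hp⟩ := hC.wall_isComponent
  exact hp ▸ connectedComponentIn_subset N p

theorem dim_ne_zero (hC : IsCoveredRegion D C N) : d ≠ 0 := by
  rintro rfl
  obtain ⟨p, hp, hwall⟩ := hC.wall_isComponent
  have hpD := (hwall ▸ mem_connectedComponentIn hp).1
  rw [(isClopen_discrete D).frontier_eq] at hpD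
  exact hpD

theorem nonneg_one_mul (hC : IsCoveredRegion D C N) (hp : p ∈ C) : 0 ≤ 1 * (p.2 - 0) := by
  simpa using (hC.snd_mem hp).1

theorem nonneg_neg_one_mul (hC : IsCoveredRegion D C N) (hp : p ∈ C) : 0 ≤ -1 * (p.2 - 1) := by
  simpa using (hC.snd_mem hp).2

theorem exists_isDefiningFunction (hC : IsCoveredRegion D C N) (hp : p ∈ N) :
    ∃ h, IsDefiningFunction C N h p := by
  have hpC := hC.side_subset hp
  have hpI := hC.snd_mem hpC
  by_cases h0 : p.2 = 0
  · refine (hC.isCobordism.corner_left p ⟨⟨hpC, h0⟩, hp⟩).exists_isDefiningFunction hC.dim_ne_zero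
      one_ne_zero (fun _ => hC.nonneg_one_mul) ?_
    filter_upwards [Iio_mem_nhds (h0.trans_lt one_pos)] with t (ht : t < 1)
    simp [ht.le]
  by_cases h1 : p.2 = 1
  · refine (hC.isCobordism.corner_right p ⟨⟨hpC, h1⟩, hp⟩).exists_isDefiningFunction hC.dim_ne_zero
      (neg_ne_zero.2 one_ne_zero) (fun _ => hC.nonneg_neg_one_mul) ?_
    filter_upwards [Ioi_mem_nhds (one_pos.trans_eq h1.symm)] with t (ht : 0 < t)
    simp [ht.le]
  · exact (hC.isCobordism.face_side p
      ⟨hp, fun h => h.elim (fun h => h0 h.2) (fun h => h1 h.2)⟩).exists_isDefiningFunction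
      ⟨hpI.1.lt_of_ne' h0, hpI.2.lt_of_ne h1⟩

theorem locallyPathConnectedSpace_side (hC : IsCoveredRegion D C N) :
    LocallyPathConnectedSpace N :=
  locallyPathConnectedSpace_of_flatAt fun _ hq =>
    have ⟨_, hh⟩ := hC.exists_isDefiningFunction hq
    hh.flatAt_side

theorem isClosed_essentialBoundary (hC : IsCoveredRegion D C N) :
    IsClosed (essentialBoundary D N) := by
  have := hC.locallyPathConnectedSpace_side
  obtain ⟨p, hp, hwall⟩ := hC.wall_isComponent
  have hB : essentialBoundary D N = Subtype.val '' (connectedComponent (⟨p, hp⟩ : N))ᶜ := by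
    rw [image_compl_eq_range_sdiff_image Subtype.val_injective, Subtype.range_coe,
      ← connectedComponentIn_eq_image hp, hwall, essentialBoundary]
  rw [hB]
  exact hC.isCobordism.isClosed_side.isClosedMap_subtype_val _
    isOpen_connectedComponent.isClosed_compl

/-- The part of `ℝᵈ × [0, 1]` outside `C` is connected near a point of the wall and misses the
wall, so it lies on one side of the wall. -/
theorem eventually_mem_of_mem_wall (hC : IsCoveredRegion D C N) (hD : IsClosed D)
    (hp : p ∈ frontier D ×ˢ Icc (0 : ℝ) 1) :
    ∀ᶠ r in 𝓝 p, r ∈ D ×ˢ Icc (0 : ℝ) 1 → r ∈ C := by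
  obtain ⟨h, hh⟩ := hC.exists_isDefiningFunction (hC.wall_subset hp)
  obtain ⟨v, hv⟩ := hh.exists_horizontal_of_forall_mem fun t ht => hC.wall_subset ⟨hp.1, ht⟩
  obtain ⟨U, hU, hpU, hpre⟩ := (hh.timeFlatAt_diff hv).flatAt.exists_isPreconnected_inter
  have hcover : U ∩ (Prod.snd ⁻¹' Icc (0 : ℝ) 1 \ C) ⊆
      Prod.fst ⁻¹' interior D ∪ Prod.fst ⁻¹' Dᶜ := by
    rintro r ⟨-, hrI, hrC⟩
    by_contra! hr
    simp only [mem_union, mem_preimage, mem_compl_iff, not_or, not_not] at hr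
    exact hrC (hC.side_subset (hC.wall_subset ⟨⟨subset_closure hr.2, hr.1⟩, hrI⟩))
  obtain ⟨z, hzU, hzD⟩ : ∃ z, (z, p.2) ∈ U ∧ z ∉ D := by
    have hpcl : p.1 ∈ closure Dᶜ := closure_compl (s := D) ▸ hp.1.2
    exact mem_closure_iff.1 hpcl _ (hU.preimage (by fun_prop : Continuous (·, p.2))) hpU
  have hzC : (z, p.2) ∉ C := fun h => hzD (hC.subset h).1
  have hout : U ∩ (Prod.snd ⁻¹' Icc (0 : ℝ) 1 \ C) ⊆ Prod.fst ⁻¹' Dᶜ := by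
    refine (hpre.subset_or_subset (isOpen_interior.preimage continuous_fst)
      (hD.isOpen_compl.preimage continuous_fst)
      ((disjoint_compl_right.mono_left interior_subset).preimage _) hcover).resolve_left fun h => ?_
    exact hzD (interior_subset (h ⟨hzU, hp.2, hzC⟩))
  filter_upwards [hU.mem_nhds hpU] with r hrU hr
  by_contra hrC
  exact hout ⟨hrU, hr.2, hrC⟩ hr.1

theorem eventually_mem_of_notMem_essentialBoundary (hC : IsCoveredRegion D C N) (hD : IsClosed D)
    (hp : p ∈ C) (hpB : p ∉ essentialBoundary D N) :
    ∀ᶠ r in 𝓝 p, r ∈ D ×ˢ Icc (0 : ℝ) 1 → r ∈ C := by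
  by_cases hpi : p ∈ interior C
  · exact Filter.eventually_of_mem (isOpen_interior.mem_nhds hpi)
      fun r hr _ => interior_subset hr
  by_cases hpN : p ∈ N
  · exact hC.eventually_mem_of_mem_wall hD (not_not.1 fun hpw => hpB ⟨hpN, hpw⟩)
  have hpf : p ∈ frontier C := ⟨subset_closure hp, hpi⟩
  rw [hC.isCobordism.boundary_eq] at hpf
  rcases hpf with (hp0 | hpN') | hp1
  · exact ((hC.isCobordism.face_left p ⟨hp0, hpN⟩).eventually_mem_of_levelSet one_ne_zero
      fun _ => hC.nonneg_one_mul).mono fun r hr hrD => hr (by simpa using hrD.2.1)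
  · exact absurd hpN' hpN
  · exact ((hC.isCobordism.face_right p ⟨hp1, hpN⟩).eventually_mem_of_levelSet
      (neg_ne_zero.2 one_ne_zero) fun _ => hC.nonneg_neg_one_mul).mono
      fun r hr hrD => hr (by simpa using hrD.2.2)

theorem isClosed_uncoveredRegion (hC : IsCoveredRegion D C N) (hD : IsClosed D) :
    IsClosed (uncoveredRegion D C N) := by
  refine isClosed_of_closure_subset ?_
  rw [uncoveredRegion, closure_union, hC.isClosed_essentialBoundary.closure_eq]
  refine union_subset (fun p hp => ?_) subset_union_right
  by_cases hpC : p ∈ C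
  · refine .inr (not_not.1 fun hpB => ?_)
    obtain ⟨r, hr, hrD, hrC⟩ := mem_closure_iff_nhds.1 hp _
      (hC.eventually_mem_of_notMem_essentialBoundary hD hpC hpB)
    exact hrC (hr hrD)
  · exact .inl ⟨closure_minimal sdiff_subset (hD.prod isClosed_Icc) hp, hpC⟩

theorem isCompact_essentialBoundary (hC : IsCoveredRegion D C N) :
    IsCompact (essentialBoundary D N) :=
  hC.isCobordism.isCompact.of_isClosed_subset hC.isClosed_essentialBoundary
    (sdiff_subset.trans hC.side_subset)

theorem uncoveredRegion_subset (hC : IsCoveredRegion D C N) :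
    uncoveredRegion D C N ⊆ D ×ˢ Icc (0 : ℝ) 1 :=
  union_subset sdiff_subset (sdiff_subset.trans (hC.side_subset.trans hC.subset))

theorem isCompact_uncoveredRegion (hC : IsCoveredRegion D C N) (hD : IsCompact D) :
    IsCompact (uncoveredRegion D C N) :=
  (hD.prod isCompact_Icc).of_isClosed_subset (hC.isClosed_uncoveredRegion hD.isClosed)
    hC.uncoveredRegion_subset

theorem fst_mem_interior (hC : IsCoveredRegion D C N) (hp : p ∈ uncoveredRegion D C N) :
    p.1 ∈ interior D := by
  by_contra hpi
  have hpD := hC.uncoveredRegion_subset hp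
  have hpw : p ∈ frontier D ×ˢ Icc (0 : ℝ) 1 := ⟨⟨subset_closure hpD.1, hpi⟩, hpD.2⟩
  exact hp.elim (fun h => h.2 (hC.side_subset (hC.wall_subset hpw))) fun h => h.2 hpw

theorem eventually_fst_mem (hC : IsCoveredRegion D C N) (hp : p ∈ uncoveredRegion D C N) :
    ∀ᶠ r in 𝓝 p, r.1 ∈ D :=
  continuous_fst.continuousAt.eventually (mem_interior_iff_mem_nhds.1 (hC.fst_mem_interior hp))

theorem exists_isDefiningFunction_uncoveredRegion (hC : IsCoveredRegion D C N)
    (hp : p ∈ essentialBoundary D N) :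
    ∃ h, IsDefiningFunction (uncoveredRegion D C N) (essentialBoundary D N) h p := by
  obtain ⟨h, hh⟩ := hC.exists_isDefiningFunction hp.1
  have hB : ∀ᶠ r in 𝓝 p, r ∈ essentialBoundary D N ↔ h r = 0 ∧ r.2 ∈ Icc (0 : ℝ) 1 := by
    filter_upwards [hh.eventually_mem_side_iff, (isClosed_wall D).isOpen_compl.mem_nhds hp.2]
      with r hr hrw
    rw [← hr]
    exact and_iff_left hrw
  refine ⟨-h, hh.contDiffAt.neg, ?_, ?_, ?_, hB.mono fun r hr => by simpa using hr⟩
  · rw [fderiv_neg]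
    exact neg_ne_zero.2 hh.fderiv_ne_zero
  · simpa [fderiv_neg] using hh.mem_Ioo_or
  · filter_upwards [hh.eventually_mem_iff, hB, hC.eventually_fst_mem (.inr hp)] with r hrC hrB hrD
    rw [uncoveredRegion, mem_union, hrB, mem_sdiff, hrC, mem_prod, Pi.neg_apply, neg_nonneg,
      and_iff_right hrD]
    rcases lt_trichotomy (h r) 0 with hr | hr | hr
    · simp [hr.le, hr.not_ge, hr.ne]
    · simp [hr]
    · simp [hr.le, hr.not_ge, hr.ne']

end IsCoveredRegion

end CoveredRegion

/-! ### Points in the same component of a set -/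

section ConnIn

variable {T : Type*} [TopologicalSpace T] {A A' : Set T} {x y z : T}

/-- The points `x` and `y` lie in a common connected subset of `A`, that is, in the same connected
component of `A`. -/
def ConnIn (A : Set T) (x y : T) : Prop :=
  ∃ K ⊆ A, IsPreconnected K ∧ x ∈ K ∧ y ∈ K

theorem ConnIn.symm (h : ConnIn A x y) : ConnIn A y x := by
  obtain ⟨K, hKA, hK, hx, hy⟩ := h
  exact ⟨K, hKA, hK, hy, hx⟩

theorem ConnIn.trans (h : ConnIn A x y) (h' : ConnIn A y z) : ConnIn A x z := by
  obtain ⟨K, hKA, hK, hx, hy⟩ := h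
  obtain ⟨K', hKA', hK', hy', hz'⟩ := h'
  exact ⟨K ∪ K', union_subset hKA hKA', hK.union y hy hy' hK', .inl hx, .inr hz'⟩

theorem ConnIn.mono (h : ConnIn A x y) (hA : A ⊆ A') : ConnIn A' x y := by
  obtain ⟨K, hKA, hK, hx, hy⟩ := h
  exact ⟨K, hKA.trans hA, hK, hx, hy⟩

theorem connIn_of_mem_connectedComponentIn (h : y ∈ connectedComponentIn A x) : ConnIn A x y :=
  ⟨_, connectedComponentIn_subset A x, isPreconnected_connectedComponentIn,
    mem_connectedComponentIn (connectedComponentIn_nonempty_iff.1 ⟨y, h⟩), h⟩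

theorem connIn_of_continuousOn {γ : ℝ → T} {a b : ℝ} (hab : a ≤ b) (hγ : ContinuousOn γ (Icc a b))
    (hA : MapsTo γ (Icc a b) A) : ConnIn A (γ a) (γ b) :=
  ⟨γ '' Icc a b, hA.image_subset, isPreconnected_Icc.image _ hγ,
    ⟨a, left_mem_Icc.2 hab, rfl⟩, ⟨b, right_mem_Icc.2 hab, rfl⟩⟩

theorem connIn_of_joined {x y : A} (h : Joined x y) : ConnIn A (x : T) y := by
  obtain ⟨γ⟩ := h
  exact ⟨range fun t => (γ t : T), range_subset_iff.2 fun t => (γ t).2,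
    isPreconnected_range (by fun_prop), ⟨0, by simp⟩, ⟨1, by simp⟩⟩

theorem ConnIn.joined [LocallyPathConnectedSpace A] {x y : A} (h : ConnIn A (x : T) y) :
    Joined x y := by
  obtain ⟨K, hKA, hK, hx, hy⟩ := h
  have hpre : IsPreconnected (Subtype.val ⁻¹' K : Set A) := by
    rwa [← Topology.IsInducing.subtypeVal.isPreconnected_image, Subtype.image_preimage_coe,
      inter_eq_right.2 hKA]
  change y ∈ pathComponent x
  rw [pathComponent_eq_connectedComponent]
  exact hpre.subset_connectedComponent hx hy

theorem isPreconnected_of_connIn (x₀ : T) (h : ∀ y ∈ A, ConnIn A x₀ y) : IsPreconnected A :=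
  isPreconnected_of_forall x₀ fun y hy =>
    have ⟨K, hKA, hK, hx, hy⟩ := h y hy
    ⟨K, hKA, hx, hy, hK⟩

end ConnIn

theorem exists_mem_and_forall_Icc_mem {T : Type*} [TopologicalSpace T] {X Y : Set T}
    (hX : IsClosed X) (hY : IsClosed Y) {γ : ℝ → T} (hγ : Continuous γ) {a b : ℝ} (hab : a ≤ b)
    (hXY : ∀ s ∈ Icc a b, γ s ∈ X ∪ Y) (ha : γ a ∈ X) (hb : γ b ∈ Y) :
    ∃ s ∈ Icc a b, γ s ∈ Y ∧ ∀ t ∈ Icc a s, γ t ∈ X := by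
  have hcompact : IsCompact (Icc a b ∩ γ ⁻¹' Y) := isCompact_Icc.inter_right (hY.preimage hγ)
  obtain ⟨s, ⟨hs, hsY⟩, hleast⟩ := hcompact.exists_isLeast ⟨b, right_mem_Icc.2 hab, hb⟩
  refine ⟨s, hs, hsY, ?_⟩
  rcases hs.1.eq_or_lt with rfl | has
  · rintro t ht
    rwa [le_antisymm ht.2 ht.1]
  · have hbefore : Ico a s ⊆ γ ⁻¹' X := fun t ht =>
      have htI : t ∈ Icc a b := ⟨ht.1, ht.2.le.trans hs.2⟩
      (hXY t htI).resolve_right fun h => (hleast ⟨htI, h⟩).not_gt ht.2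
    have hclosure := closure_minimal hbefore (hX.preimage hγ)
    rwa [closure_Ico has.ne] at hclosure

theorem exists_connIn_of_convex {T : Type*} [AddCommGroup T] [Module ℝ T] [TopologicalSpace T]
    [IsTopologicalAddGroup T] [ContinuousSMul ℝ T] {X Y A : Set T} (hX : IsClosed X)
    (hY : IsClosed Y) (hA : Convex ℝ A) (hAXY : A ⊆ X ∪ Y) {x y : T} (hx : x ∈ X ∩ A)
    (hy : y ∈ Y ∩ A) : ∃ z ∈ X ∩ Y ∩ A, ConnIn (X ∩ A) x z := by
  let γ : ℝ → T := AffineMap.lineMap x y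
  have hγ : Continuous γ := by
    simp only [γ]
    fun_prop
  have hγ0 : γ 0 = x := AffineMap.lineMap_apply_zero x y
  have hγ1 : γ 1 = y := AffineMap.lineMap_apply_one x y
  have hγA : MapsTo γ (Icc 0 1) A := fun s hs => hA.lineMap_mem hx.2 hy.2 hs
  obtain ⟨s, hs, hsY, hsX⟩ := exists_mem_and_forall_Icc_mem hX hY hγ zero_le_one
    (fun s hs => hAXY (hγA hs)) (hγ0 ▸ hx.1) (hγ1 ▸ hy.1)
  refine ⟨γ s, ⟨⟨hsX s (right_mem_Icc.2 hs.1), hsY⟩, hγA hs⟩, ?_⟩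
  rw [← hγ0]
  exact connIn_of_continuousOn hs.1 hγ.continuousOn fun t ht =>
    ⟨hsX t ht, hγA ⟨ht.1, ht.2.trans hs.2⟩⟩

/-! ### Connectivity of uncovered regions -/

section Slab

variable {d : ℕ} {M M' : Set (SpaceTime d)} {a b t : ℝ}

theorem slab_eq_inter (M : Set (SpaceTime d)) (a b : ℝ) :
    slab M a b = M ∩ Prod.snd ⁻¹' Icc a b := rfl

theorem levelSet_eq_inter (M : Set (SpaceTime d)) (t : ℝ) :
    levelSet M t = M ∩ Prod.snd ⁻¹' {t} := rfl

theorem levelSet_eq_slab (M : Set (SpaceTime d)) (t : ℝ) : levelSet M t = slab M t t := by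
  rw [levelSet_eq_inter, slab_eq_inter, Icc_self]

theorem slab_mono (h : M ⊆ M') (a b : ℝ) : slab M a b ⊆ slab M' a b :=
  inter_subset_inter_left _ h

theorem isClosed_slab (hM : IsClosed M) (a b : ℝ) : IsClosed (slab M a b) :=
  hM.inter (isClosed_Icc.preimage continuous_snd)

theorem isCompact_slab (hM : IsCompact M) (a b : ℝ) : IsCompact (slab M a b) :=
  hM.inter_right (isClosed_Icc.preimage continuous_snd)

theorem convex_snd_preimage {s : Set ℝ} (hs : Convex ℝ s) :
    Convex ℝ (Prod.snd ⁻¹' s : Set (SpaceTime d)) :=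
  hs.linear_preimage (LinearMap.snd ℝ (Space d) ℝ)

theorem exists_mem_levelSet_inter (hM : IsPreconnected (levelSet M t)) {U V : Set (SpaceTime d)}
    (hU : IsClosed U) (hV : IsClosed V) (hMUV : levelSet M t ⊆ U ∪ V)
    (hMU : t ∈ Prod.snd '' (M ∩ U)) (hMV : t ∈ Prod.snd '' (M ∩ V)) :
    (levelSet M t ∩ (U ∩ V)).Nonempty := by
  obtain ⟨p, ⟨hpM, hpU⟩, hpt⟩ := hMU
  obtain ⟨q, ⟨hqM, hqV⟩, hqt⟩ := hMV
  exact isPreconnected_closed_iff.1 hM U V hU hV hMUV ⟨p, ⟨hpM, hpt⟩, hpU⟩ ⟨q, ⟨hqM, hqt⟩, hqV⟩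

theorem isPreconnected_slab (hM : IsCompact M) (h : ∀ t ∈ Icc a b, IsConnected (levelSet M t)) :
    IsPreconnected (slab M a b) := by
  rw [isPreconnected_closed_iff]
  rintro U V hU hV hUV ⟨u, hu, huU⟩ ⟨v, hv, hvV⟩
  have hslab := isCompact_slab hM a b
  have himage : Icc a b ⊆ Prod.snd '' (slab M a b ∩ U) ∪ Prod.snd '' (slab M a b ∩ V) := by
    rw [← image_union, ← inter_union_distrib_left, inter_eq_left.2 hUV]
    intro t ht
    obtain ⟨p, hp⟩ := (h t ht).nonempty
    exact ⟨p, levelSet_subset_slab M ht hp, hp.2⟩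
  obtain ⟨t, ht, htU, htV⟩ := isPreconnected_closed_iff.1 isPreconnected_Icc _ _
    ((hslab.inter_right hU).image continuous_snd).isClosed
    ((hslab.inter_right hV).image continuous_snd).isClosed himage
    ⟨u.2, hu.2, u, ⟨hu, huU⟩, rfl⟩ ⟨v.2, hv.2, v, ⟨hv, hvV⟩, rfl⟩
  have hsub := levelSet_subset_slab M ht
  have hslice_image : ∀ W, t ∈ Prod.snd '' (slab M a b ∩ W) → t ∈ Prod.snd '' (M ∩ W) := fun W h =>
    image_mono (inter_subset_inter_left W fun p hp => hp.1) h
  exact (exists_mem_levelSet_inter (h t ht).isPreconnected hU hV (hsub.trans hUV)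
    (hslice_image U htU) (hslice_image V htV)).mono (inter_subset_inter_left _ hsub)

end Slab

section Connectivity

variable {d : ℕ} {D : Set (Space d)} {C N : Set (SpaceTime d)} {a b t : ℝ}

/-- The union of the covered region `C` with everything over `[0, 1]` outside `D`. Together with the
uncovered region it fills `ℝᵈ × [0, 1]`, and the two meet in the essential boundary. -/
def outerRegion (D : Set (Space d)) (C : Set (SpaceTime d)) : Set (SpaceTime d) :=
  C ∪ Dᶜ ×ˢ Icc (0 : ℝ) 1

namespace IsCoveredRegion

theorem mem_of_mem_closure_compl (hC : IsCoveredRegion D C N) {p : SpaceTime d} (hp : p.1 ∈ D)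
    (hp' : p.1 ∈ closure Dᶜ) (ht : p.2 ∈ Icc (0 : ℝ) 1) : p ∈ C :=
  hC.side_subset (hC.wall_subset ⟨⟨subset_closure hp, by rwa [closure_compl] at hp'⟩, ht⟩)

theorem closure_compl_prod_subset_outerRegion (hC : IsCoveredRegion D C N) :
    closure Dᶜ ×ˢ Icc (0 : ℝ) 1 ⊆ outerRegion D C := fun p hp => by
  by_cases hpD : p.1 ∈ D
  · exact .inl (hC.mem_of_mem_closure_compl hpD hp.1 hp.2)
  · exact .inr ⟨hpD, hp.2⟩

theorem isClosed_outerRegion (hC : IsCoveredRegion D C N) : IsClosed (outerRegion D C) := by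
  have heq : outerRegion D C = C ∪ closure Dᶜ ×ˢ Icc (0 : ℝ) 1 :=
    Subset.antisymm (union_subset_union_right _ (prod_mono subset_closure subset_rfl))
      (union_subset subset_union_left hC.closure_compl_prod_subset_outerRegion)
  rw [heq]
  exact hC.isClosed.union (isClosed_closure.prod isClosed_Icc)

theorem essentialBoundary_subset_outerRegion (hC : IsCoveredRegion D C N) :
    essentialBoundary D N ⊆ outerRegion D C := fun _ hp => .inl (hC.side_subset hp.1)

theorem uncoveredRegion_inter_outerRegion (hC : IsCoveredRegion D C N) :
    uncoveredRegion D C N ∩ outerRegion D C = essentialBoundary D N := by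
  refine Subset.antisymm ?_ fun p hp => ⟨.inr hp, hC.essentialBoundary_subset_outerRegion hp⟩
  rintro p ⟨⟨hpD, hpC⟩ | hpB, hpC' | hpD'⟩
  · exact absurd hpC' hpC
  · exact absurd hpD.1 hpD'.1
  · exact hpB
  · exact hpB

theorem uncoveredRegion_union_outerRegion (hC : IsCoveredRegion D C N) :
    uncoveredRegion D C N ∪ outerRegion D C = Prod.snd ⁻¹' Icc (0 : ℝ) 1 := by
  refine Subset.antisymm (union_subset (fun p hp => (hC.uncoveredRegion_subset hp).2)
    (union_subset (fun p hp => hC.snd_mem hp) fun p hp => hp.2)) fun p hp => ?_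
  by_cases hpC : p ∈ C
  · exact .inr (.inl hpC)
  · by_cases hpD : p.1 ∈ D
    · exact .inl (.inl ⟨⟨hpD, hp⟩, hpC⟩)
    · exact .inr (.inr ⟨hpD, hp⟩)

theorem slab_uncoveredRegion_inter_slab_outerRegion (hC : IsCoveredRegion D C N) (a b : ℝ) :
    slab (uncoveredRegion D C N) a b ∩ slab (outerRegion D C) a b =
      slab (essentialBoundary D N) a b := by
  rw [slab_eq_inter, slab_eq_inter, ← inter_inter_distrib_right,
    hC.uncoveredRegion_inter_outerRegion, slab_eq_inter]

theorem slab_uncoveredRegion_union_slab_outerRegion (hC : IsCoveredRegion D C N)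
    (hab : Icc a b ⊆ Icc 0 1) :
    slab (uncoveredRegion D C N) a b ∪ slab (outerRegion D C) a b = Prod.snd ⁻¹' Icc a b := by
  rw [slab_eq_inter, slab_eq_inter, ← union_inter_distrib_right,
    hC.uncoveredRegion_union_outerRegion, inter_eq_right]
  exact preimage_mono hab

theorem exists_connIn_levelSet_outerRegion (hC : IsCoveredRegion D C N) (hD : IsClosed D)
    (ht : t ∈ Icc (0 : ℝ) 1) (hne : (levelSet C t).Nonempty) {y : SpaceTime d}
    (hy : y ∈ levelSet (outerRegion D C) t) :
    ∃ z ∈ levelSet C t, ConnIn (levelSet (outerRegion D C) t) y z := by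
  obtain ⟨hyC | hyD, rfl⟩ := hy
  · exact ⟨y, ⟨hyC, rfl⟩, {y}, singleton_subset_iff.2 ⟨.inl hyC, rfl⟩, isPreconnected_singleton,
      rfl, rfl⟩
  obtain ⟨x, hx, hxt⟩ := hne
  obtain ⟨z, ⟨⟨hz, hz'⟩, hzt⟩, hyz⟩ := exists_connIn_of_convex
    (isClosed_closure.preimage continuous_fst) (hD.preimage continuous_fst)
    (convex_snd_preimage (convex_singleton y.2)) (fun p _ => by
      rw [← preimage_union]
      exact (em (p.1 ∈ D)).elim .inr fun h => .inl (subset_closure h))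
    ⟨subset_closure hyD.1, rfl⟩ ⟨(hC.subset hx).1, hxt⟩
  have htI : ∀ {p : SpaceTime d}, p ∈ Prod.snd ⁻¹' {y.2} → p.2 ∈ Icc (0 : ℝ) 1 :=
    fun hp => mem_singleton_iff.1 hp ▸ ht
  exact ⟨z, ⟨hC.mem_of_mem_closure_compl hz' hz (htI hzt), hzt⟩, hyz.mono fun p hp =>
    ⟨hC.closure_compl_prod_subset_outerRegion ⟨hp.1, htI hp.2⟩, hp.2⟩⟩

theorem isPreconnected_slab_outerRegion (hC : IsCoveredRegion D C N) (hD : IsClosed D)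
    (hab : Icc a b ⊆ Icc 0 1) (hconn : ∀ t ∈ Icc a b, IsConnected (levelSet C t)) :
    IsPreconnected (slab (outerRegion D C) a b) := by
  rcases (slab (outerRegion D C) a b).eq_empty_or_nonempty with hempty | ⟨x, hx⟩
  · exact hempty ▸ isPreconnected_empty
  have hslab : IsPreconnected (slab C a b) :=
    isPreconnected_slab hC.isCobordism.isCompact hconn
  have hconnC : ∀ y ∈ slab (outerRegion D C) a b,
      ∃ z ∈ slab C a b, ConnIn (slab (outerRegion D C) a b) y z := fun y hy => by
    obtain ⟨z, hz, hyz⟩ := hC.exists_connIn_levelSet_outerRegion hD (hab hy.2)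
      (hconn _ hy.2).nonempty ⟨hy.1, rfl⟩
    exact ⟨z, levelSet_subset_slab C hy.2 hz, hyz.mono (levelSet_subset_slab _ hy.2)⟩
  obtain ⟨x', hx', hxx'⟩ := hconnC x hx
  refine isPreconnected_of_connIn x fun y hy => ?_
  obtain ⟨y', hy', hyy'⟩ := hconnC y hy
  exact (hxx'.trans ⟨slab C a b, slab_mono subset_union_left a b, hslab, hx', hy'⟩).trans hyy'.symm

theorem connIn_slab_essentialBoundary (hC : IsCoveredRegion D C N) (hD : IsClosed D)
    (hab : Icc a b ⊆ Icc 0 1) (hconn : ∀ t ∈ Icc a b, IsConnected (levelSet C t))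
    {x y : SpaceTime d} (hx : x ∈ essentialBoundary D N) (hy : y ∈ essentialBoundary D N)
    (h : ConnIn (slab (uncoveredRegion D C N) a b) x y) :
    ConnIn (slab (essentialBoundary D N) a b) x y := by
  obtain ⟨K, hK, hKc, hxK, hyK⟩ := h
  have hinter := hC.slab_uncoveredRegion_inter_slab_outerRegion a b
  have hunion := hC.slab_uncoveredRegion_union_slab_outerRegion hab
  have hcontractible : ContractibleSpace
      (slab (uncoveredRegion D C N) a b ∪ slab (outerRegion D C) a b : Set (SpaceTime d)) :=
    (hunion ▸ convex_snd_preimage (convex_Icc a b)).contractibleSpace ⟨x, .inl (hK hxK)⟩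
  have hmem := mem_connectedComponentIn_inter_of_contractible
    (isClosed_slab (hC.isClosed_uncoveredRegion hD) a b) (isClosed_slab hC.isClosed_outerRegion a b)
    (hC.isPreconnected_slab_outerRegion hD hab hconn)
    (hinter ▸ isCompact_slab hC.isCompact_essentialBoundary a b) hKc hK
    hxK ⟨hC.essentialBoundary_subset_outerRegion hx, (hK hxK).2⟩
    hyK ⟨hC.essentialBoundary_subset_outerRegion hy, (hK hyK).2⟩
  exact connIn_of_mem_connectedComponentIn (hinter ▸ hmem)

theorem exists_connIn_levelSet (hC : IsCoveredRegion D C N) (hD : IsClosed D)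
    (ht : t ∈ Icc (0 : ℝ) 1) (hne : (levelSet C t).Nonempty) {x : SpaceTime d}
    (hx : x ∈ levelSet (uncoveredRegion D C N) t) :
    ∃ z ∈ levelSet (essentialBoundary D N) t,
      ConnIn (levelSet (uncoveredRegion D C N) t) x z := by
  obtain ⟨y, hy, hyt⟩ := hne
  have hcover : Prod.snd ⁻¹' {t} ⊆ uncoveredRegion D C N ∪ outerRegion D C := by
    rw [hC.uncoveredRegion_union_outerRegion]
    exact preimage_mono (singleton_subset_iff.2 ht)
  obtain ⟨z, hz, hxz⟩ := exists_connIn_of_convex (hC.isClosed_uncoveredRegion hD)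
    hC.isClosed_outerRegion (convex_snd_preimage (convex_singleton t)) hcover hx ⟨.inl hy, hyt⟩
  rw [hC.uncoveredRegion_inter_outerRegion] at hz
  exact ⟨z, hz, hxz⟩

end IsCoveredRegion

end Connectivity

/-! ### Sections over slabs -/

section Restriction

theorem FlatAt.inter_of_mem_nhds {T : Type*} [NormedAddCommGroup T] [NormedSpace ℝ T] {Z W : Set T}
    {q : T} (h : FlatAt Z q) (hW : W ∈ 𝓝 q) : FlatAt (Z ∩ W) q := by
  obtain ⟨F, hq, K, hK, hZ⟩ := h
  exact ⟨F, hq, K, hK, (hZ.and hW).mono fun r hr => (and_iff_left hr.2).trans hr.1⟩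

variable {E : Type*} [TopologicalSpace E] {Z : Set (E × ℝ)} {p : E × ℝ} {J : Set ℝ}

theorem OpensAt.inter_snd_preimage (h : OpensAt Z p) (hJ : J ∈ 𝓝 p.2) :
    OpensAt (Z ∩ Prod.snd ⁻¹' J) p := by
  obtain ⟨⟨I, hI, hmono⟩, hnhds⟩ := h
  refine ⟨⟨I ∩ J, Filter.inter_mem hI hJ, hmono.mono fun v hv t ht t' ht' htt' hvt =>
    ⟨hv ht.1 ht'.1 htt' hvt.1, ht'.2⟩⟩, ?_⟩
  filter_upwards [hnhds, nhdsWithin_le_nhds (eventually_mem_nhds_iff.2 hJ)] with s hs hsJ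
  exact Filter.inter_mem hs (continuous_snd.continuousAt.preimage_mem_nhds hsJ)

theorem ClosesAt.inter_snd_preimage (h : ClosesAt Z p) (hJ : J ∈ 𝓝 p.2) :
    ClosesAt (Z ∩ Prod.snd ⁻¹' J) p := by
  obtain ⟨⟨I, hI, hanti⟩, hnhds⟩ := h
  refine ⟨⟨I ∩ J, Filter.inter_mem hI hJ, hanti.mono fun v hv t ht t' ht' htt' hvt =>
    ⟨hv ht.1 ht'.1 htt' hvt.1, ht.2⟩⟩, ?_⟩
  filter_upwards [hnhds, nhdsWithin_le_nhds (eventually_mem_nhds_iff.2 hJ)] with s hs hsJ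
  exact Filter.inter_mem hs (continuous_snd.continuousAt.preimage_mem_nhds hsJ)

end Restriction

section Sections

variable {d : ℕ} {D : Set (Space d)} {B C N : Set (SpaceTime d)} {p : SpaceTime d} {a b : ℝ}

theorem IsCriticalPoint.snd_mem_Ioo (hp : IsCriticalPoint B p) (hpt : p.2 ∈ Icc a b)
    (ha : a ∉ criticalValues B) (hb : b ∉ criticalValues B) : p.2 ∈ Ioo a b :=
  ⟨hpt.1.lt_of_ne fun h => ha ⟨p, hp, h.symm⟩, hpt.2.lt_of_ne fun h => hb ⟨p, hp, h⟩⟩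

theorem IsCriticalPoint.of_essentialBoundary (hp : IsCriticalPoint (essentialBoundary D N) p) :
    IsCriticalPoint N p := by
  refine ⟨hp.1.1, fun v hv => hp.2 v ?_⟩
  rwa [← tangentConeAt_inter_nhds ((isClosed_wall D).isOpen_compl.mem_nhds hp.1.2)] at hv

namespace IsCoveredRegion

theorem timeFlatAt_of_notMem (hC : IsCoveredRegion D C N) (hp : p ∈ uncoveredRegion D C N)
    (hpB : p ∉ essentialBoundary D N) : TimeFlatAt (uncoveredRegion D C N) p := by
  have hpC : p ∉ C := (hp.resolve_right hpB).2
  refine timeFlatAt_of_mem_iff (convex_Icc 0 1) ?_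
  filter_upwards [hC.eventually_fst_mem hp, hC.isClosed.isOpen_compl.mem_nhds hpC] with r hrD hrC
  exact ⟨fun hr => (hC.uncoveredRegion_subset hr).2, fun hr => .inl ⟨⟨hrD, hr⟩, hrC⟩⟩

theorem timeFlatAt_or_isCriticalPoint (hC : IsCoveredRegion D C N)
    (hp : p ∈ essentialBoundary D N) :
    (TimeFlatAt (uncoveredRegion D C N) p ∧ TimeFlatAt (essentialBoundary D N) p) ∨
      (IsCriticalPoint (essentialBoundary D N) p ∧
        (OpensAt (uncoveredRegion D C N) p ∨ ClosesAt (uncoveredRegion D C N) p)) := by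
  obtain ⟨h, hh⟩ := hC.exists_isDefiningFunction_uncoveredRegion hp
  by_cases hz : ∀ v, fderiv ℝ h p (v, 0) = 0
  · exact .inr ⟨hh.isCriticalPoint hp hz, hh.opensAt_or_closesAt hp hz⟩
  · obtain ⟨v, hv⟩ := not_forall.1 hz
    exact .inl ⟨hh.timeFlatAt hv, hh.timeFlatAt_side hv⟩

theorem locallyPathConnectedSpace_slab (hC : IsCoveredRegion D C N)
    (ha : a ∉ criticalValues (essentialBoundary D N))
    (hb : b ∉ criticalValues (essentialBoundary D N)) :
    LocallyPathConnectedSpace (slab (essentialBoundary D N) a b) := by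
  refine locallyPathConnectedSpace_of_flatAt fun q hq => ?_
  rcases hC.timeFlatAt_or_isCriticalPoint hq.1 with h | ⟨hcrit, -⟩
  · exact (h.2.inter (convex_Icc a b)).flatAt
  · obtain ⟨h, hh⟩ := hC.exists_isDefiningFunction_uncoveredRegion hq.1
    have hqt := hcrit.snd_mem_Ioo hq.2 ha hb
    exact hh.flatAt_side.inter_of_mem_nhds (eventually_snd_mem (Icc_mem_nhds hqt.1 hqt.2))

theorem isCriticalPoint_of_not_regularAt_slab (hC : IsCoveredRegion D C N)
    (hp : p ∈ slab (uncoveredRegion D C N) a b)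
    (hreg : ¬ RegularAt (slab (uncoveredRegion D C N) a b) p) :
    IsCriticalPoint (essentialBoundary D N) p ∧
      (OpensAt (uncoveredRegion D C N) p ∨ ClosesAt (uncoveredRegion D C N) p) := by
  have hflat : ¬ TimeFlatAt (uncoveredRegion D C N) p := fun h =>
    hreg (h.inter (convex_Icc a b)).regularAt
  have hpB : p ∈ essentialBoundary D N :=
    not_not.1 fun hpB => hflat (hC.timeFlatAt_of_notMem hp.1 hpB)
  exact (hC.timeFlatAt_or_isCriticalPoint hpB).resolve_left fun h => hflat h.1

theorem reach_of_connIn (hC : IsCoveredRegion D C N) (hD : IsCompact D)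
    (ha : a ∉ criticalValues (essentialBoundary D N))
    (hb : b ∉ criticalValues (essentialBoundary D N)) (hab : a < b)
    (hsub : (criticalValues (essentialBoundary D N) ∩ Icc a b).Subsingleton) {x y : SpaceTime d}
    (hx : x.2 = a) (hy : y.2 = b) (h : ConnIn (slab (uncoveredRegion D C N) a b) x y) :
    Reach (slab (uncoveredRegion D C N) a b) x y := by
  obtain ⟨K, hKX, hK, hxK, hyK⟩ := h
  subst hx hy
  refine reach_of_isPreconnected_of_subsingleton
    (isCompact_slab (hC.isCompact_uncoveredRegion hD) _ _) (fun z hz => hz.2) hab ?_ ?_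
    hK hKX hxK hyK
  · rintro z ⟨hz, hzreg⟩ w ⟨hw, hwreg⟩
    have hzcrit := (hC.isCriticalPoint_of_not_regularAt_slab hz hzreg).1
    have hwcrit := (hC.isCriticalPoint_of_not_regularAt_slab hw hwreg).1
    exact hC.critical_injOn hzcrit.of_essentialBoundary hwcrit.of_essentialBoundary
      (hsub ⟨⟨z, hzcrit, rfl⟩, hz.2⟩ ⟨⟨w, hwcrit, rfl⟩, hw.2⟩)
  · intro z hz hzreg
    obtain ⟨hzcrit, hmodel⟩ := hC.isCriticalPoint_of_not_regularAt_slab hz hzreg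
    have hzt := hzcrit.snd_mem_Ioo hz.2 ha hb
    have hIcc := Icc_mem_nhds hzt.1 hzt.2
    exact ⟨hzt, hmodel.imp (fun h => h.inter_snd_preimage hIcc) fun h => h.inter_snd_preimage hIcc⟩

end IsCoveredRegion

end Sections

/-! ### Characters of `H⁰` -/

section Characters

variable {k A : Type*} [Field k] [TopologicalSpace A]

/-- The `0`-simplex at a point. -/
def pointSimplex (x : A) : SingularSimplex 0 A := ContinuousMap.const _ x

theorem eq_pointSimplex (σ : SingularSimplex 0 A) :
    σ = pointSimplex (σ (stdSimplex.vertex 0)) := by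
  ext v
  have : Subsingleton (stdSimplex ℝ (Fin (0 + 1))) :=
    inferInstanceAs (Subsingleton (stdSimplex ℝ (Fin 1)))
  rw [Subsingleton.elim v (stdSimplex.vertex 0)]
  rfl

theorem face_eq_pointSimplex (σ : SingularSimplex 1 A) (i : Fin (1 + 1)) :
    σ.face i = pointSimplex (σ (stdSimplex.vertex (i.succAbove 0))) := by
  rw [eq_pointSimplex (σ.face i)]
  simp [SingularSimplex.face]

/-- The `1`-simplex traversing a path backwards, so that its `i`-th face is at the `i`-th end. -/
noncomputable def pathSimplex {x y : A} (γ : Path x y) : SingularSimplex 1 A where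
  toFun v := γ.extend (v.1 0)
  continuous_toFun :=
    γ.continuous_extend.comp ((continuous_apply 0).comp continuous_subtype_val)

theorem pathSimplex_face_zero {x y : A} (γ : Path x y) :
    (pathSimplex γ).face 0 = pointSimplex x := by
  rw [face_eq_pointSimplex]
  simp [pathSimplex]

theorem pathSimplex_face_one {x y : A} (γ : Path x y) :
    (pathSimplex γ).face 1 = pointSimplex y := by
  rw [face_eq_pointSimplex]
  simp [pathSimplex]

theorem joined_simplex_apply {n : ℕ} (σ : SingularSimplex n A)
    (v w : stdSimplex ℝ (Fin (n + 1))) : Joined (σ v) (σ w) := by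
  have : PathConnectedSpace (stdSimplex ℝ (Fin (n + 1))) :=
    isPathConnected_iff_pathConnectedSpace.1
      ((convex_stdSimplex ℝ (Fin (n + 1))).isPathConnected ⟨v, v.2⟩)
  exact (PathConnectedSpace.joined v w).map σ.continuous

theorem mem_H0_iff_face {φ : SingularCochain 0 k A} :
    φ ∈ H0 k A ↔ ∀ σ : SingularSimplex 1 A, φ (σ.face 0) = φ (σ.face 1) := by
  refine funext_iff.trans (forall_congr' fun σ => ?_)
  rw [coboundary_zero_apply, Pi.zero_apply, sub_eq_zero]

theorem mem_H0_iff {φ : SingularCochain 0 k A} :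
    φ ∈ H0 k A ↔ ∀ x y, Joined x y → φ (pointSimplex x) = φ (pointSimplex y) := by
  rw [mem_H0_iff_face]
  refine ⟨fun h x y ⟨γ⟩ => ?_, fun h σ => ?_⟩
  · rw [← pathSimplex_face_zero γ, h, pathSimplex_face_one]
  · rw [face_eq_pointSimplex, face_eq_pointSimplex]
    exact h _ _ (joined_simplex_apply σ _ _)

/-- Evaluation at a point, as a character of `H⁰`. -/
def evalAt (k : Type*) [Field k] (x : A) : H0Dual k A :=
  (Pi.evalAlgHom k (fun _ : SingularSimplex 0 A => k) (pointSimplex x)).comp (H0 k A).val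

theorem H0_ext {φ ψ : H0 k A} (h : ∀ x, evalAt k x φ = evalAt k x ψ) : φ = ψ := by
  refine Subtype.ext (funext fun σ => ?_)
  rw [eq_pointSimplex σ]
  exact h _

open Classical in
/-- The indicator function of the path component of a point, as an element of `H⁰`. -/
noncomputable def componentIndicator (k : Type*) [Field k] (x : A) : H0 k A :=
  ⟨fun σ => if Joined x (σ (stdSimplex.vertex 0)) then 1 else 0, mem_H0_iff.2 fun _ _ h =>
    if_congr ⟨fun hy => hy.trans h, fun hz => hz.trans h.symm⟩ rfl rfl⟩

theorem evalAt_componentIndicator_of_joined {x y : A} (h : Joined x y) :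
    evalAt k y (componentIndicator k x) = 1 :=
  if_pos h

theorem evalAt_componentIndicator_of_not_joined {x y : A} (h : ¬ Joined x y) :
    evalAt k y (componentIndicator k x) = 0 :=
  if_neg h

theorem evalAt_eq_iff_joined {x y : A} : evalAt k x = evalAt k y ↔ Joined x y := by
  refine ⟨fun h => ?_, fun h => AlgHom.ext fun φ => mem_H0_iff.1 φ.2 x y h⟩
  by_contra hxy
  have heval := DFunLike.congr_fun h (componentIndicator k x)
  rw [evalAt_componentIndicator_of_joined (Joined.refl x),
    evalAt_componentIndicator_of_not_joined hxy] at heval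
  exact one_ne_zero heval

theorem mul_componentIndicator (φ : H0 k A) (x : A) :
    φ * componentIndicator k x = evalAt k x φ • componentIndicator k x := by
  refine H0_ext fun y => ?_
  rw [map_mul, map_smul, smul_eq_mul]
  by_cases h : Joined x y
  · rw [evalAt_eq_iff_joined.2 h]
  · rw [evalAt_componentIndicator_of_not_joined h, mul_zero, mul_zero]

/-- Finitely many path components cover, so a character is nonzero on the indicator of one. -/
theorem exists_eq_evalAt [CompactSpace A] [LocallyPathConnectedSpace A] (χ : H0Dual k A) :
    ∃ x, χ = evalAt k x := by
  obtain ⟨t, ht⟩ := isCompact_univ.elim_finite_subcover (fun x : A => pathComponent x)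
    (fun x => IsOpen.pathComponent x) fun x _ => mem_iUnion.2 ⟨x, mem_pathComponent_self x⟩
  have hprod : ∏ x ∈ t, (1 - componentIndicator k x) = 0 := H0_ext fun y => by
    obtain ⟨x, hx, hxy⟩ := mem_iUnion₂.1 (ht (mem_univ y))
    rw [map_prod, map_zero]
    refine Finset.prod_eq_zero hx ?_
    rw [map_sub, map_one, evalAt_componentIndicator_of_joined hxy, sub_self]
  obtain ⟨x, -, hx⟩ : ∃ x ∈ t, χ (1 - componentIndicator k x) = 0 := by
    rw [← Finset.prod_eq_zero_iff, ← map_prod, hprod, map_zero]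
  rw [map_sub, map_one, sub_eq_zero] at hx
  refine ⟨x, AlgHom.ext fun φ => ?_⟩
  have hmul := congrArg χ (mul_componentIndicator φ x)
  rwa [map_mul, map_smul, ← hx, mul_one, smul_eq_mul, mul_one] at hmul

end Characters

/-! ### From evasion paths to the inverse limit -/

theorem reach_through {E : Type*} [TopologicalSpace E] {Z : Set (E × ℝ)} {n : ℕ}
    {x : Fin (n + 1) → E × ℝ} (hx : StrictMono fun i => (x i).2) (hx₀ : x 0 ∈ Z)
    (hreach : ∀ i : Fin n, Reach Z (x i.castSucc) (x i.succ)) (j : Fin (n + 1)) :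
    Reach {p ∈ Z | ∀ i, p.2 = (x i).2 → p = x i} (x 0) (x j) := by
  have hstep : ∀ i : Fin n,
      Reach {p ∈ Z | ∀ i, p.2 = (x i).2 → p = x i} (x i.castSucc) (x i.succ) := fun i => by
    obtain ⟨hle, σ, hσ, hσZ, hleft, hright⟩ := hreach i
    refine ⟨hle, σ, hσ, fun t ht => ⟨hσZ t ht, fun j hj => ?_⟩, hleft, hright⟩
    obtain rfl : t = (x j).2 := hj
    rcases (hx.le_iff_le.1 ht.1).eq_or_lt with rfl | hlt
    · exact Prod.ext hleft rfl
    · obtain rfl : j = i.succ :=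
        le_antisymm (hx.le_iff_le.1 ht.2) (Fin.castSucc_lt_iff_succ_le.1 hlt)
      exact Prod.ext hright rfl
  induction j using Fin.induction with
  | zero => exact Reach.refl ⟨hx₀, fun i hi => congrArg x (hx.injective hi)⟩
  | succ i ih => exact ih.trans (hstep i)

section EvasionPath

variable {d : ℕ} {D : Set (Space d)} {C N : Set (SpaceTime d)}

/-- The position of an evasion path at time `t`, constant outside `[0, 1]`. -/
noncomputable def EvasionPath.pos (δ : EvasionPath D C N) : ℝ → SpaceTime d :=
  IccExtend zero_le_one fun t : unitInterval => (δ.1 t : SpaceTime d)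

namespace EvasionPath

theorem pos_apply (δ : EvasionPath D C N) {t : ℝ} (ht : t ∈ Icc (0 : ℝ) 1) :
    δ.pos t = (δ.1 ⟨t, ht⟩ : SpaceTime d) :=
  IccExtend_of_mem _ _ ht

theorem continuous_pos (δ : EvasionPath D C N) : Continuous δ.pos :=
  (continuous_subtype_val.comp δ.1.continuous).Icc_extend'

theorem pos_mem (δ : EvasionPath D C N) {t : ℝ} (ht : t ∈ Icc (0 : ℝ) 1) :
    δ.pos t ∈ levelSet (uncoveredRegion D C N) t := by
  rw [δ.pos_apply ht]
  exact ⟨(δ.1 ⟨t, ht⟩).2, δ.2 ⟨t, ht⟩⟩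

theorem connIn_slab (δ : EvasionPath D C N) {a b : ℝ} (hab : a ≤ b) (hI : Icc a b ⊆ Icc 0 1) :
    ConnIn (slab (uncoveredRegion D C N) a b) (δ.pos a) (δ.pos b) :=
  connIn_of_continuousOn hab δ.continuous_pos.continuousOn fun _ ht =>
    levelSet_subset_slab _ ht (δ.pos_mem (hI ht))

theorem connIn_levelSet_of_joined {δ δ' : EvasionPath D C N} (h : Joined δ δ') {t : ℝ}
    (ht : t ∈ Icc (0 : ℝ) 1) :
    ConnIn (levelSet (uncoveredRegion D C N) t) (δ.pos t) (δ'.pos t) := by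
  obtain ⟨γ⟩ := h
  have hpath : Continuous fun s => (γ s).1 := continuous_subtype_val.comp γ.continuous
  have hpos : Continuous fun s => (γ s).pos t :=
    continuous_subtype_val.comp ((continuous_eval_const _).comp hpath)
  exact ⟨range fun s => (γ s).pos t, range_subset_iff.2 fun s => (γ s).pos_mem ht,
    isPreconnected_range hpos, ⟨0, by simp⟩, ⟨1, by simp⟩⟩

end EvasionPath

end EvasionPath

section Levels

variable {d : ℕ} {D : Set (Space d)} {C N : Set (SpaceTime d)} {a b t : ℝ}

namespace IsCoveredRegion

theorem isCompact_levelSet (hC : IsCoveredRegion D C N) (t : ℝ) :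
    IsCompact (levelSet (essentialBoundary D N) t) := by
  rw [levelSet_eq_slab]
  exact isCompact_slab hC.isCompact_essentialBoundary t t

theorem locallyPathConnectedSpace_levelSet (hC : IsCoveredRegion D C N)
    (ht : t ∉ criticalValues (essentialBoundary D N)) :
    LocallyPathConnectedSpace (levelSet (essentialBoundary D N) t) := by
  rw [levelSet_eq_slab]
  exact hC.locallyPathConnectedSpace_slab ht ht

theorem joined_slab_of_connIn (hC : IsCoveredRegion D C N) (hD : IsClosed D)
    (hab : Icc a b ⊆ Icc 0 1) (hconn : ∀ t ∈ Icc a b, IsConnected (levelSet C t))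
    (ha : a ∉ criticalValues (essentialBoundary D N))
    (hb : b ∉ criticalValues (essentialBoundary D N)) {x y : slab (essentialBoundary D N) a b}
    (h : ConnIn (slab (uncoveredRegion D C N) a b) (x : SpaceTime d) y) : Joined x y :=
  have := hC.locallyPathConnectedSpace_slab ha hb
  (hC.connIn_slab_essentialBoundary hD hab hconn x.2.1 y.2.1 h).joined

theorem joined_levelSet_of_connIn (hC : IsCoveredRegion D C N) (hD : IsClosed D)
    (htI : t ∈ Icc (0 : ℝ) 1) (hconn : IsConnected (levelSet C t))
    (ht : t ∉ criticalValues (essentialBoundary D N)) {x y : levelSet (essentialBoundary D N) t}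
    (h : ConnIn (levelSet (uncoveredRegion D C N) t) (x : SpaceTime d) y) : Joined x y := by
  have := hC.locallyPathConnectedSpace_levelSet ht
  rw [levelSet_eq_slab] at h
  have hB := hC.connIn_slab_essentialBoundary hD (by simpa using htI) (by simpa using hconn)
    x.2.1 y.2.1 h
  rw [← levelSet_eq_slab] at hB
  exact hB.joined

end IsCoveredRegion

end Levels

section ZigzagLimit

variable {k : Type*} [Field k] {d n : ℕ} {D : Set (Space d)} {B C M N : Set (SpaceTime d)}

namespace Interleaving

variable (S : Interleaving B n)

theorem mem_Icc (i : Fin (n + 1)) : S.s i ∈ Icc (0 : ℝ) 1 := by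
  rw [← S.zero, ← S.last]
  exact ⟨S.strictMono.monotone (Fin.zero_le i), S.strictMono.monotone (Fin.le_last i)⟩

theorem lt (i : Fin n) : S.s i.castSucc < S.s i.succ :=
  S.strictMono i.castSucc_lt_succ

theorem Icc_subset (i j : Fin (n + 1)) : Icc (S.s i) (S.s j) ⊆ Icc 0 1 :=
  Icc_subset_Icc (S.mem_Icc i).1 (S.mem_Icc j).2

theorem exists_evasionPath {x : Fin (n + 1) → SpaceTime d}
    (hx : ∀ i, x i ∈ levelSet (uncoveredRegion D C N) (S.s i))
    (hreach : ∀ i : Fin n, Reach (uncoveredRegion D C N) (x i.castSucc) (x i.succ)) :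
    ∃ δ : EvasionPath D C N, ∀ i, δ.pos (S.s i) = x i := by
  have hx_time : (fun i => (x i).2) = S.s := funext fun i => (hx i).2
  obtain ⟨-, σ, hσ, hσX, -, -⟩ :=
    reach_through (hx_time ▸ S.strictMono) (hx 0).1 hreach (Fin.last n)
  rw [(hx _).2, (hx _).2, S.zero, S.last] at hσ hσX
  have hsection : Continuous fun t : unitInterval => ((σ t, (t : ℝ)) : SpaceTime d) :=
    (continuousOn_iff_continuous_domRestrict.1 hσ).prodMk continuous_subtype_val
  let δ : EvasionPath D C N :=
    ⟨⟨fun t => ⟨(σ t, t), (hσX t t.2).1⟩, hsection.subtype_mk _⟩, fun _ => rfl⟩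
  refine ⟨δ, fun i => ?_⟩
  rw [δ.pos_apply (S.mem_Icc i)]
  exact (hσX _ (S.mem_Icc i)).2 i (hx i).2.symm

end Interleaving

variable {S : Interleaving B n}

theorem H0Dual_map_evalAt {A A' : Type*} [TopologicalSpace A] [TopologicalSpace A'] (f : C(A, A'))
    (x : A) : H0Dual.map f (evalAt k x) = evalAt k (f x) := rfl

theorem ZigzagLimit.ext_levels {χ χ' : ZigzagLimit k S M} (h : ∀ i, χ.1.1 i = χ'.1.1 i) :
    χ = χ' := by
  refine Subtype.ext (Prod.ext (funext h) (funext fun i => ?_))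
  rw [← (χ.2 i).1, ← (χ'.2 i).1, h]

theorem exists_zigzagLimit_of_joined (z : ∀ i, levelSet M (S.s i))
    (hz : ∀ i, Joined (S.inclLeft M i (z i.castSucc)) (S.inclRight M i (z i.succ))) :
    ∃ χ : ZigzagLimit k S M, ∀ i, χ.1.1 i = evalAt k (z i) :=
  ⟨⟨(fun i => evalAt k (z i), fun i => evalAt k (S.inclLeft M i (z i.castSucc))),
    fun i => ⟨rfl, (evalAt_eq_iff_joined.2 (hz i)).symm⟩⟩, fun _ => rfl⟩

theorem ZigzagLimit.joined_of_eq_evalAt (χ : ZigzagLimit k S M) {z : ∀ i, levelSet M (S.s i)}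
    (hz : ∀ i, χ.1.1 i = evalAt k (z i)) (i : Fin n) :
    Joined (S.inclLeft M i (z i.castSucc)) (S.inclRight M i (z i.succ)) := by
  rw [← evalAt_eq_iff_joined (k := k), ← H0Dual_map_evalAt, ← H0Dual_map_evalAt, ← hz, ← hz,
    (χ.2 i).1, (χ.2 i).2]

end ZigzagLimit

section Main

variable {k : Type u} [Field k] {d n : ℕ} {D : Set (Space d)} {C N : Set (SpaceTime d)}
  {S : Interleaving (essentialBoundary D N) n}

/-- The evasion path `δ` induces the compatible family of characters `χ`: at each time `sᵢ`, the
character is evaluation at the boundary points in the component of the uncovered slice that contains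
`δ(sᵢ)`. -/
def Induces (δ : EvasionPath D C N) (χ : ZigzagLimit k S (essentialBoundary D N)) : Prop :=
  ∀ i (z : levelSet (essentialBoundary D N) (S.s i)),
    ConnIn (levelSet (uncoveredRegion D C N) (S.s i)) (δ.pos (S.s i)) z → χ.1.1 i = evalAt k z

namespace IsCoveredRegion

theorem eq_of_induces (hC : IsCoveredRegion D C N) (hD : IsClosed D)
    (hne : ∀ t ∈ Icc (0 : ℝ) 1, (levelSet C t).Nonempty) {δ δ' : EvasionPath D C N}
    (hδ : Joined δ δ') {χ χ' : ZigzagLimit k S (essentialBoundary D N)} (h : Induces δ χ)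
    (h' : Induces δ' χ') : χ = χ' := by
  refine ZigzagLimit.ext_levels fun i => ?_
  have hI := S.mem_Icc i
  obtain ⟨z, hz, hδz⟩ := hC.exists_connIn_levelSet hD hI (hne _ hI) (δ.pos_mem hI)
  have hδ'z := (EvasionPath.connIn_levelSet_of_joined hδ hI).symm.trans hδz
  exact (h i ⟨z, hz⟩ hδz).trans (h' i ⟨z, hz⟩ hδ'z).symm

theorem exists_induces (hC : IsCoveredRegion D C N) (hD : IsClosed D)
    (hconn : ∀ t ∈ Icc (0 : ℝ) 1, IsConnected (levelSet C t)) (δ : EvasionPath D C N) :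
    ∃ χ : ZigzagLimit k S (essentialBoundary D N), Induces δ χ := by
  have hI := S.mem_Icc
  choose z hz hδz using fun i =>
    hC.exists_connIn_levelSet hD (hI i) (hconn _ (hI i)).nonempty (δ.pos_mem (hI i))
  obtain ⟨χ, hχ⟩ := exists_zigzagLimit_of_joined (k := k) (fun i => ⟨z i, hz i⟩) fun i => by
    have hsub := S.Icc_subset i.castSucc i.succ
    have hle := (S.lt i).le
    refine hC.joined_slab_of_connIn hD hsub (fun t ht => hconn t (hsub ht)) (S.regular _)
      (S.regular _) ?_
    have hleft := (hδz i.castSucc).mono (levelSet_subset_slab _ (left_mem_Icc.2 hle))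
    have hright := (hδz i.succ).mono (levelSet_subset_slab _ (right_mem_Icc.2 hle))
    exact hleft.symm.trans ((δ.connIn_slab hle hsub).trans hright)
  refine ⟨χ, fun i w hw => (hχ i).trans (evalAt_eq_iff_joined.2 ?_)⟩
  exact hC.joined_levelSet_of_connIn hD (hI i) (hconn _ (hI i)) (S.regular i)
    ((hδz i).symm.trans hw)

theorem exists_evasionPath_induces (hC : IsCoveredRegion D C N) (hD : IsCompact D)
    (hconn : ∀ t ∈ Icc (0 : ℝ) 1, IsConnected (levelSet C t))
    (χ : ZigzagLimit k S (essentialBoundary D N)) : ∃ δ : EvasionPath D C N, Induces δ χ := by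
  have hI := S.mem_Icc
  have hpoint : ∀ i, ∃ x, χ.1.1 i = evalAt k x := fun i =>
    have := hC.locallyPathConnectedSpace_levelSet (S.regular i)
    have := isCompact_iff_compactSpace.1 (hC.isCompact_levelSet (S.s i))
    exists_eq_evalAt _
  choose x hx using hpoint
  have hBX : essentialBoundary D N ⊆ uncoveredRegion D C N := subset_union_right
  have hreach : ∀ i : Fin n, Reach (uncoveredRegion D C N) (x i.castSucc : SpaceTime d)
      (x i.succ) := fun i => by
    have hconnIn := (connIn_of_joined (χ.joined_of_eq_evalAt hx i)).mono (slab_mono hBX _ _)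
    exact (hC.reach_of_connIn hD (S.regular _) (S.regular _) (S.lt i) (S.subsingleton i)
      (x i.castSucc).2.2 (x i.succ).2.2 hconnIn).mono fun _ hw _ => hw.1
  obtain ⟨δ, hδ⟩ := S.exists_evasionPath (fun i => ⟨hBX (x i).2.1, (x i).2.2⟩) hreach
  refine ⟨δ, fun i w hw => (hx i).trans (evalAt_eq_iff_joined.2 ?_)⟩
  rw [hδ] at hw
  exact hC.joined_levelSet_of_connIn hD.isClosed (hI i) (hconn _ (hI i)) (S.regular i) hw

theorem exists_surjective_zigzagLimit (hC : IsCoveredRegion D C N) (hD : IsCompact D)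
    (hconn : ∀ t ∈ Icc (0 : ℝ) 1, IsConnected (levelSet C t)) :
    ∃ F : ZerothHomotopy (EvasionPath D C N) → ZigzagLimit k S (essentialBoundary D N),
      Function.Surjective F := by
  choose G hG using hC.exists_induces (k := k) (S := S) hD.isClosed hconn
  have hunique {δ δ'} (hδ : Joined δ δ') {χ} (h : Induces δ' χ) : G δ = χ :=
    hC.eq_of_induces hD.isClosed (fun t ht => (hconn t ht).nonempty) hδ (hG δ) h
  refine ⟨Quotient.lift G fun δ δ' hδ => hunique hδ (hG δ'), fun χ => ?_⟩
  obtain ⟨δ, hδ⟩ := hC.exists_evasionPath_induces hD hconn χ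
  exact ⟨Quotient.mk _ δ, hunique (Joined.refl δ) hδ⟩

end IsCoveredRegion

end Main

end Evasion

theorem mainTheorem3_general {k : Type u} [Field k] {d : ℕ} {D : Set (Evasion.Space d)}
    (hD : IsCompact D) {C N : Set (Evasion.SpaceTime d)} (hC : Evasion.IsCoveredRegion D C N)
    (hconn : ∀ t ∈ Set.Icc (0 : ℝ) 1, IsConnected (Evasion.levelSet C t))
    {n : ℕ} (S : Evasion.Interleaving (Evasion.essentialBoundary D N) n) :
    (∃ F : ZerothHomotopy (Evasion.EvasionPath D C N) →
        Evasion.ZigzagLimit k S (Evasion.essentialBoundary D N), Function.Surjective F) ∧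
    (Nonempty (Evasion.EvasionPath D C N) ↔
      Nonempty (Evasion.ZigzagLimit k S (Evasion.essentialBoundary D N))) ∧
    Cardinal.mk (Evasion.ZigzagLimit k S (Evasion.essentialBoundary D N)) ≤
      Cardinal.lift.{u} (Cardinal.mk (ZerothHomotopy (Evasion.EvasionPath D C N))) := by
  obtain ⟨F, hF⟩ := hC.exists_surjective_zigzagLimit (k := k) (S := S) hD hconn
  refine ⟨⟨F, hF⟩, ⟨fun ⟨δ⟩ => ⟨F (Quotient.mk _ δ)⟩, fun ⟨χ⟩ => ?_⟩, ?_⟩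
  · obtain ⟨q, -⟩ := hF χ
    exact ⟨q.out⟩
  · rw [← Cardinal.mk_uLift]
    exact Cardinal.mk_le_of_surjective (hF.comp ULift.down_surjective)

theorem mainTheorem3 {k : Type u} [Field k] {d : ℕ} (hd : 2 ≤ d)
    (D : Set (Evasion.Space d)) (hD : Evasion.IsSmoothBall D)
    (C N : Set (Evasion.SpaceTime d)) (hC : Evasion.IsCoveredRegion D C N)
    (hconn : ∀ t ∈ Set.Icc (0 : ℝ) 1, IsConnected (Evasion.levelSet C t))
    {n : ℕ} (S : Evasion.Interleaving (Evasion.essentialBoundary D N) n) :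
    (∃ F : ZerothHomotopy (Evasion.EvasionPath D C N) →
        Evasion.ZigzagLimit k S (Evasion.essentialBoundary D N), Function.Surjective F) ∧
    (Nonempty (Evasion.EvasionPath D C N) ↔
      Nonempty (Evasion.ZigzagLimit k S (Evasion.essentialBoundary D N))) ∧
    Cardinal.mk (Evasion.ZigzagLimit k S (Evasion.essentialBoundary D N)) ≤
      Cardinal.lift.{u} (Cardinal.mk (ZerothHomotopy (Evasion.EvasionPath D C N))) :=
  mainTheorem3_general hD.isCompact hC hconn S
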